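/- **Notation.** $B(x,r)$ is a closed ball and $\dim_{\mathrm H}$ is Hausdorff dimension. For $x \in \mathbb{R}^2$, let $\pi_x(y) = \frac{y-x}{|y-x|}$, $y \neq x$, be the radial projection. In a metric space $(X,d)$, $|A|_\delta$ denotes the smallest number of closed balls of radius $\delta$ needed to cover $A$, and $|A|$ denotes cardinality. For $\delta, C > 0$ and $s \ge 0$, a set $P \subset X$ with $|P|_\delta < \infty$ is a *$(\delta,s,C)$-set* if $$|P \cap B(x,r)|_\delta \le C r^s |P|_\delta \qquad \text{for all } x \in X,\ r \ge \delta.$$ The space $\mathcal{A}(2,1)$ of affine lines in $\mathbb{R}^2$ has the metric $d(\ell_1,\ell_2) = \|\pi_{L_1} - \pi_{L_2}\| + |a_1 - a_2|$, where $\pi_{L_j}$ is the orthogonal projection to the subspace $L_j$ parallel to $\ell_j$, $\|\cdot\|$ is the operator norm, and $\{a_j\} = L_j^\perp \cap \ell_j$. A *$\delta$-tube* is the closed $\delta$-neighbourhood $\ell(\delta)$ of a line $\ell$. A family of $\delta$-tubes $\{\ell(\delta) : \ell \in \mathcal{L}\}$ is a $(\delta,s,C)$-set if $\mathcal{L} \subset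 \mathcal{A}(2,1)$ is a $(\delta,s,C)$-set. A set is *$\delta$-separated* if any two distinct points of it have distance $> \delta$. **Proposition.** Let $t \in [0,2]$ and $\sigma \in (0,1)$. Let $K \subset B(0,1) \subset \mathbb{R}^2$ be a compact set with $\dim_{\mathrm H} K > t$, write $$E := \{x \in \mathbb{R}^2 \setminus K : \dim_{\mathrm H} \pi_x(K) < \sigma\},$$ and assume that $\dim_{\mathrm H} E > s \ge 0$. Then, for every $\delta_0 \in (0,1)$ and $\epsilon \in (0,1-\sigma)$, there exist $\Delta \in (0,\delta_0]$ and $\Sigma \in [0,\sigma+\epsilon]$ such that the following objects exist: 1. a non-empty finite $\Delta$-separated $(\Delta,t,\Delta^{-\epsilon})$-set $P_K \subset K$; 2. a non-empty finite $\Delta$-separated $(\Delta,s,\Delta^{-\epsilon})$-set $P_E \subset E$; 3. for every $x \in P_E$, a non-empty $(\Delta,\Sigma,\Delta^{-\epsilon})$-set $\mathcal{T}_x$ of $\Delta$-tubes such that $x \in T$ and $$|T \cap P_K| \ge \Delta^{\Sigma+\epsilon} |P_K| \qquad \text{for all } T \in \mathcal{T}_x.$$ -/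

import Mathlib

open scoped ENNReal

/-- The Euclidean plane. -/
abbrev Plane : Type := EuclideanSpace ℝ (Fin 2)

/-- Radial projection `π_x(y) = (y - x) / |y - x|`, to be used for `y ≠ x`. -/
noncomputable def radialProj (x y : Plane) : Plane := ‖y - x‖⁻¹ • (y - x)

/-- The set of points `x ∉ K` with `dim_H π_x(K) < σ`. -/
def exceptionalSet (K : Set Plane) (σ : ℝ) : Set Plane :=
  {x | x ∉ K ∧ dimH (radialProj x '' K) < ENNReal.ofReal σ}

/-- The covering number `|A|_r`: the smallest number of closed balls of radius `r`, with
arbitrary centres in `X`, required to cover `A`. -/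
noncomputable def ballCoveringNumber {X : Type*} [MetricSpace X] (r : ℝ) (A : Set X) : ℕ∞ :=
  Metric.externalCoveringNumber r.toNNReal A

/-- `P` is a `(δ, s, C)`-set: `|P ∩ B(x, r)|_δ ≤ C r ^ s |P|_δ` for all `x ∈ X` and `r ≥ δ`.
The first clause says that `|P|_δ` is a number; in the plane and in the space of lines
this means that `P` is bounded. -/
def IsDeltaSet {X : Type*} [MetricSpace X] (δ s C : ℝ) (P : Set X) : Prop :=
  ballCoveringNumber δ P ≠ ⊤ ∧
  ∀ (x : X) (r : ℝ), δ ≤ r →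
    (ballCoveringNumber δ (P ∩ Metric.closedBall x r) : ℝ≥0∞) ≤
      ENNReal.ofReal (C * r ^ s) * (ballCoveringNumber δ P : ℝ≥0∞)

/-- An affine line in the plane. -/
@[ext]
structure PlaneLine where
  carrier : AffineSubspace ℝ Plane
  nonempty : (carrier : Set Plane).Nonempty
  finrank_direction : Module.finrank ℝ carrier.direction = 1

namespace PlaneLine

/-- The orthogonal projection of the plane onto the direction `L` of the line. -/
noncomputable def dirProj (l : PlaneLine) : Plane →L[ℝ] Plane :=
  l.carrier.direction.starProjection

theorem exists_foot (l : PlaneLine) :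
    ∃! a : Plane, a ∈ l.carrier ∧ a ∈ (l.carrier.direction)ᗮ := by
  obtain ⟨p, hp⟩ := l.nonempty
  refine ⟨p - l.carrier.direction.starProjection p, ⟨?_, ?_⟩, ?_⟩
  · have h : -(l.carrier.direction.starProjection p) ∈ l.carrier.direction :=
      neg_mem (Submodule.starProjection_apply_mem _ p)
    have := AffineSubspace.vadd_mem_of_mem_direction h hp
    simpa [sub_eq_add_neg, add_comm] using this
  · exact Submodule.sub_starProjection_mem_orthogonal p
  · rintro b ⟨hb, hb'⟩
    set a := p - l.carrier.direction.starProjection p with ha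
    have ha1 : a ∈ (l.carrier.direction)ᗮ := Submodule.sub_starProjection_mem_orthogonal p
    have h1 : b - p ∈ l.carrier.direction := AffineSubspace.vsub_mem_direction hb hp
    have h2 : b - a ∈ l.carrier.direction := by
      have : b - a = (b - p) + l.carrier.direction.starProjection p := by rw [ha]; abel
      rw [this]
      exact add_mem h1 (Submodule.starProjection_apply_mem _ p)
    have h3 : b - a ∈ (l.carrier.direction)ᗮ := sub_mem hb' ha1
    have h4 : b - a = 0 := by
      have := Submodule.inner_right_of_mem_orthogonal h2 h3
      exact inner_self_eq_zero.mp this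
    exact sub_eq_zero.mp h4

/-- The unique point `a` of the line that is orthogonal to its direction:
`{a} = L^⊥ ∩ ℓ`. -/
noncomputable def foot (l : PlaneLine) : Plane := l.exists_foot.choose

theorem foot_mem (l : PlaneLine) : l.foot ∈ l.carrier := l.exists_foot.choose_spec.1.1

theorem foot_mem_orthogonal (l : PlaneLine) : l.foot ∈ (l.carrier.direction)ᗮ :=
  l.exists_foot.choose_spec.1.2

/-- The metric `d(ℓ₁, ℓ₂) = ‖π_{L₁} - π_{L₂}‖ + |a₁ - a₂|` on the space of lines, with the
operator norm and the Euclidean norm. -/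
noncomputable instance : MetricSpace PlaneLine where
  dist l₁ l₂ := ‖l₁.dirProj - l₂.dirProj‖ + ‖l₁.foot - l₂.foot‖
  dist_self l := by simp
  dist_comm l₁ l₂ := by rw [norm_sub_rev, norm_sub_rev l₁.foot]
  dist_triangle l₁ l₂ l₃ := by
    have h1 := norm_sub_le_norm_sub_add_norm_sub l₁.dirProj l₂.dirProj l₃.dirProj
    have h2 := norm_sub_le_norm_sub_add_norm_sub l₁.foot l₂.foot l₃.foot
    linarith
  eq_of_dist_eq_zero := by
    intro l₁ l₂ h
    have h : ‖l₁.dirProj - l₂.dirProj‖ + ‖l₁.foot - l₂.foot‖ = 0 := h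
    have h1 : l₁.dirProj = l₂.dirProj := by
      rw [← sub_eq_zero, ← norm_eq_zero]
      linarith [norm_nonneg (l₁.dirProj - l₂.dirProj), norm_nonneg (l₁.foot - l₂.foot)]
    have h2 : l₁.foot = l₂.foot := by
      rw [← sub_eq_zero, ← norm_eq_zero]
      linarith [norm_nonneg (l₁.dirProj - l₂.dirProj), norm_nonneg (l₁.foot - l₂.foot)]
    have h3 : l₁.carrier.direction = l₂.carrier.direction :=
      Submodule.starProjection_inj.mp h1
    apply PlaneLine.ext
    exact AffineSubspace.ext_of_direction_eq h3 ⟨l₁.foot, l₁.foot_mem, h2 ▸ l₂.foot_mem⟩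

/-- The `δ`-tube `ℓ(δ)` around a line: its closed `δ`-neighbourhood. -/
def tube (δ : ℝ) (l : PlaneLine) : Set Plane := Metric.cthickening δ (l.carrier : Set Plane)

end PlaneLine

/-- `𝒯` is a `(δ, s, C)`-set of `δ`-tubes: it is the family of `δ`-tubes around the lines of
some `(δ, s, C)`-set of lines. -/
def IsDeltaTubeSet (δ s C : ℝ) (𝒯 : Set (Set Plane)) : Prop :=
  ∃ 𝓛 : Set PlaneLine, 𝒯 = PlaneLine.tube δ '' 𝓛 ∧ IsDeltaSet δ s C 𝓛

/-! Let `μ` be a Frostman probability measure on `K` and `O` a Frostman-type outer measure charging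
`E`. No measurability of `E` is available, so on that side only countable subadditivity is used.

For `x ∈ E`, the line `join x y` is a Lipschitz function of the direction `π_x(y)`, so the image of
`μ` under `join x` lives on a set of dimension below `σ`. By the mass distribution principle, the
points whose image balls have mass at most `r ^ σ` at all small scales form a null set. Discretising
exponents in steps of `η = ε / 5` gives some `d = i * η < σ` for which mass at most `r ^ d` at all
small scales holds on a set of positive mass, while the same with `d + η` holds only on a null set.
Almost every point of that set then sees about `Δ ^ (d + η)` or more at infinitely many dyadic
scales `Δ`, and at most `r ^ d` at every small radius. Comparing the two bounds shows that the lines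
found at such a scale form a `(Δ, d)`-set, and that their tubes are heavy. The data `(i, n, N)`
(exponent, threshold scale, bound for `‖x‖`) are countable, so `O` charges the `x` sharing one
choice; this fixes `Σ = d`.

It remains to make the scale and the set `P_K` independent of `x`. At each scale `K` is cut, up to
mass `121 * Δ`, into a bounded number of mass classes, on each of which counting points agrees with
`μ` up to a factor `Δ ^ η`. A Borel–Cantelli argument for `μ` (`exists_le_measure_goodPart`) gives
each `x` infinitely many scales with a good class. A second one, for `O`
(`exists_le_outerMeasure_setOf_goodPart`), gives one scale and one class good for a set of `x` of
`O`-mass at least `Δ ^ η`. The discrete Frostman lemma extracts `P_E` from that set, and the points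
of the class are `P_K`. -/

/-! ### Frostman lemmas, discrete and continuous. -/

open MeasureTheory Metric Set in
/-- A set of Hausdorff dimension larger than `s` is charged by an outer measure that is at most
`diam ^ s` on sets of small diameter. -/
theorem exists_outerMeasure_of_lt_dimH {X : Type*} [MetricSpace X] {A : Set X} {s : ℝ}
    (hs : 0 ≤ s) (h : ENNReal.ofReal s < dimH A) :
    ∃ (O : OuterMeasure X) (ρ : ℝ), 0 < ρ ∧ O A ≠ 0 ∧
      ∀ S, ediam S ≤ ENNReal.ofReal ρ → O S ≤ ediam S ^ s := by
  borelize X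
  by_contra! hcon
  -- The candidates are the premeasures of size `ρ`. They tend to `μH[s]` as `ρ → 0`, so if all of
  -- them vanished on `A`, so would `μH[s]`, which is infinite there.
  have h0 : ∀ ρ : ℝ, 0 < ρ →
      OuterMeasure.mkMetric'.pre (fun S : Set X => ediam S ^ s) (ENNReal.ofReal ρ) A = 0 := by
    intro ρ hρ
    by_contra hne
    obtain ⟨S, hS, hlt⟩ := hcon _ ρ hρ hne
    exact absurd (OuterMeasure.mkMetric'.pre_le hS) (not_le.2 hlt)
  have htop : μH[s] A = ∞ := by
    have := hausdorffMeasure_of_lt_dimH (s := A) (d := s.toNNReal) h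
    rwa [Real.coe_toNNReal _ hs] at this
  have h1 : OuterMeasure.mkMetric' (fun S : Set X => ediam S ^ s) A = 0 := by
    refine tendsto_nhds_unique (OuterMeasure.mkMetric'.tendsto_pre _ A)
      (tendsto_const_nhds.congr' ?_)
    filter_upwards [Ioo_mem_nhdsGT (show (0 : ℝ≥0∞) < 1 by simp)] with r hr
    have hr' : r ≠ ∞ := (hr.2.trans ENNReal.one_lt_top).ne
    rw [← ENNReal.ofReal_toReal hr', h0 _ (ENNReal.toReal_pos hr.1.ne' hr')]
  have h2 : μH[s] A = OuterMeasure.mkMetric' (fun S : Set X => ediam S ^ s) A := by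
    rw [Measure.hausdorffMeasure, ← Measure.coe_toOuterMeasure, Measure.mkMetric_toOuterMeasure]
    rfl
  rw [h2, h1] at htop
  exact ENNReal.zero_ne_top htop

open Metric Set in
/-- A totally bounded set contains a finite set of maximal cardinality among those that have at
most `(r / δ) ^ s` points in each ball of radius `r ∈ [δ, ρ]`. Each point of the set is in a ball
which is nearly saturated. -/
theorem exists_finset_saturated {X : Type*} [MetricSpace X] {s ρ δ : ℝ} {A : Set X}
    (hA : TotallyBounded A) (hs : 0 ≤ s) (hδ : 0 < δ) (hδρ : δ ≤ ρ) :
    ∃ P : Finset X, ↑P ⊆ A ∧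
      (∀ x r, δ ≤ r → r ≤ ρ → (((P : Set X) ∩ closedBall x r).ncard : ℝ) ≤ (r / δ) ^ s) ∧
      ∀ a ∈ A, ∃ x r, δ ≤ r ∧ r ≤ ρ ∧ a ∈ closedBall x r ∧
        (r / δ) ^ s ≤ 2 * (((P : Set X) ∩ closedBall x r).ncard : ℝ) := by
  classical
  let Good : Finset X → Prop := fun P => ↑P ⊆ A ∧
      ∀ x r, δ ≤ r → r ≤ ρ → (((P : Set X) ∩ closedBall x r).ncard : ℝ) ≤ (r / δ) ^ s
  obtain ⟨t, htfin, htcov⟩ := Metric.totallyBounded_iff.1 hA δ hδ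
  -- The condition at `r = δ` allows one point per `δ`-ball, so a finite `δ`-net bounds the
  -- cardinality and a maximum exists.
  have hbound : ∀ P, Good P → P.card ≤ htfin.toFinset.card := by
    intro P hP
    have hex : ∀ p ∈ P, ∃ y ∈ htfin.toFinset, p ∈ closedBall y δ := by
      intro p hp
      obtain ⟨y, hy, hpy⟩ := mem_iUnion₂.1 (htcov (hP.1 hp))
      exact ⟨y, by simpa using hy, ball_subset_closedBall hpy⟩
    choose! y hyt hpy using hex
    refine Finset.card_le_card_of_injOn y hyt ?_
    intro p hp q hq hpq
    have h1 := hP.2 (y p) δ le_rfl hδρ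
    rw [div_self hδ.ne', Real.one_rpow] at h1
    have h2 : ((P : Set X) ∩ closedBall (y p) δ).ncard ≤ 1 := by exact_mod_cast h1
    exact (Set.ncard_le_one (P.finite_toSet.inter_of_left _)).1 h2 p ⟨hp, hpy p hp⟩ q
      ⟨hq, by rw [hpq]; exact hpy q hq⟩
  have hne : ({n | ∃ P, Good P ∧ P.card = n} : Set ℕ).Nonempty :=
    ⟨0, ∅, ⟨by simp, fun x r h _ => by
      simpa using Real.rpow_nonneg (div_nonneg (hδ.le.trans h) hδ.le) s⟩, rfl⟩
  have hbdd : BddAbove ({n | ∃ P, Good P ∧ P.card = n} : Set ℕ) :=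
    ⟨_, by rintro n ⟨P, hP, rfl⟩; exact hbound P hP⟩
  obtain ⟨P, hP, hPcard⟩ := Nat.sSup_mem hne hbdd
  refine ⟨P, hP.1, hP.2, fun a ha => ?_⟩
  by_cases haP : a ∈ P
  · refine ⟨a, δ, le_rfl, hδρ, mem_closedBall_self hδ.le, ?_⟩
    rw [div_self hδ.ne', Real.one_rpow]
    have : 1 ≤ ((P : Set X) ∩ closedBall a δ).ncard :=
      (Set.ncard_pos (P.finite_toSet.inter_of_left _)).2 ⟨a, haP, mem_closedBall_self hδ.le⟩
    have : (1 : ℝ) ≤ ((P : Set X) ∩ closedBall a δ).ncard := by exact_mod_cast this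
    linarith
  · have hnot : ¬ Good (insert a P) := by
      intro hg
      have := le_csSup hbdd ⟨_, hg, rfl⟩
      rw [Finset.card_insert_of_notMem haP, hPcard] at this
      omega
    have hsub : ((insert a P : Finset X) : Set X) ⊆ A := by
      intro z hz
      rcases Finset.mem_insert.1 hz with rfl | hz
      · exact ha
      · exact hP.1 hz
    have : ¬ ∀ x r, δ ≤ r → r ≤ ρ →
        ((((insert a P : Finset X) : Set X) ∩ closedBall x r).ncard : ℝ) ≤ (r / δ) ^ s :=
      fun h => hnot ⟨hsub, h⟩
    push Not at this
    obtain ⟨x, r, hr, hrρ, hlt⟩ := this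
    -- By maximality, adding `a` overfills some ball. That ball must contain `a`, as otherwise `P`
    -- alone would overfill it.
    have hax : a ∈ closedBall x r := by
      by_contra hax
      rw [Finset.coe_insert, Set.insert_inter_of_notMem hax] at hlt
      exact absurd (hP.2 x r hr hrρ) (not_le.2 hlt)
    refine ⟨x, r, hr, hrρ, hax, ?_⟩
    rw [Finset.coe_insert, Set.insert_inter_of_mem hax] at hlt
    have h1 := Set.ncard_insert_le a ((P : Set X) ∩ closedBall x r)
    -- The count before insertion plus one exceeds `(r / δ) ^ s ≥ 1`, so the count is at least `1`
    -- and the added one is absorbed by the factor `2`.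
    have h2 : (1 : ℝ) ≤ (r / δ) ^ s :=
      Real.one_le_rpow ((one_le_div hδ).2 hr) hs
    have h3 : ((insert a ((P : Set X) ∩ closedBall x r)).ncard : ℝ) ≤
        ((P : Set X) ∩ closedBall x r).ncard + 1 := by exact_mod_cast h1
    have h4 : 1 ≤ ((P : Set X) ∩ closedBall x r).ncard := by
      have : (0 : ℝ) < ((P : Set X) ∩ closedBall x r).ncard := by linarith
      exact_mod_cast this
    have h5 : (1 : ℝ) ≤ ((P : Set X) ∩ closedBall x r).ncard := by exact_mod_cast h4
    linarith

open MeasureTheory Metric Set in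
/-- Discrete Frostman lemma. -/
theorem exists_finset_frostman {X : Type*} [MetricSpace X] {O : OuterMeasure X} {s ρ δ : ℝ}
    {A : Set X} (hO : ∀ S, ediam S ≤ ENNReal.ofReal ρ → O S ≤ ediam S ^ s)
    (hA : TotallyBounded A) (hs : 0 ≤ s) (hδ : 0 < δ) (hδρ : δ ≤ ρ / 10) :
    ∃ P : Finset X, ↑P ⊆ A ∧
      (∀ x r, δ ≤ r → r ≤ ρ / 10 →
        (((P : Set X) ∩ closedBall x r).ncard : ℝ) ≤ (r / δ) ^ s) ∧
      O A ≤ ENNReal.ofReal (2 * 10 ^ s * δ ^ s * P.card) := by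
  classical
  obtain ⟨P, hPA, hP, hsat⟩ := exists_finset_saturated hA hs hδ hδρ
  refine ⟨P, hPA, hP, ?_⟩
  choose! x r hδr hrρ hmem hbig using hsat
  -- Disjoint saturated balls count points of `P` without repetition, while their fivefold
  -- enlargements cover `A`. The enlargements have diameter at most `10 * r ≤ ρ`, hence the bound `ρ
  -- / 10` on radii.
  obtain ⟨u, huA, hdisj, hcov⟩ := Vitali.exists_disjoint_subfamily_covering_enlargement_closedBall
    A x r (ρ / 10) (fun a ha => hrρ a ha) 5 (by norm_num)
  have hne : ∀ a ∈ u, ((P : Set X) ∩ closedBall (x a) (r a)).Nonempty := by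
    intro a ha
    rw [← Set.ncard_pos (P.finite_toSet.inter_of_left _)]
    have h1 := hbig a (huA ha)
    have h2 : (0 : ℝ) < (r a / δ) ^ s :=
      Real.rpow_pos_of_pos (div_pos (hδ.trans_le (hδr a (huA ha))) hδ) s
    have : (0 : ℝ) < ((P : Set X) ∩ closedBall (x a) (r a)).ncard := by linarith
    exact_mod_cast this
  have hufin : u.Finite := by
    choose! p hp using hne
    refine Set.Finite.of_finite_image (f := p)
      (P.finite_toSet.subset (by rintro _ ⟨a, ha, rfl⟩; exact (hp a ha).1)) ?_
    intro a ha b hb hab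
    by_contra hne
    exact Set.disjoint_left.1 (hdisj ha hb hne) (hp a ha).2 (hab ▸ (hp b hb).2)
  have hsum : ∑ a ∈ hufin.toFinset, ((P : Set X) ∩ closedBall (x a) (r a)).ncard ≤ P.card := by
    have h1 : ∀ a, ((P : Set X) ∩ closedBall (x a) (r a)).ncard =
        (P.filter (· ∈ closedBall (x a) (r a))).card := by
      intro a
      rw [← Set.ncard_coe_finset]
      congr 1
      ext z
      simp
    simp_rw [h1]
    rw [← Finset.card_biUnion]
    · exact Finset.card_le_card (Finset.biUnion_subset.2 fun a _ => Finset.filter_subset _ _)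
    · intro a ha b hb hab
      refine Finset.disjoint_left.2 ?_
      intro z hz hz'
      exact Set.disjoint_left.1 (hdisj (by simpa using ha) (by simpa using hb) hab)
        (Finset.mem_filter.1 hz).2 (Finset.mem_filter.1 hz').2
  have hsub : A ⊆ ⋃ a ∈ hufin.toFinset, closedBall (x a) (5 * r a) := by
    intro a ha
    obtain ⟨b, hb, hab⟩ := hcov a ha
    exact mem_biUnion (by simpa using hb) (hab (hmem a ha))
  calc O A ≤ ∑ a ∈ hufin.toFinset, O (closedBall (x a) (5 * r a)) :=
        (measure_mono hsub).trans (measure_biUnion_finset_le _ _)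
    _ ≤ ∑ a ∈ hufin.toFinset, ENNReal.ofReal
          (2 * 10 ^ s * δ ^ s * ((P : Set X) ∩ closedBall (x a) (r a)).ncard) := by
        refine Finset.sum_le_sum fun a ha => ?_
        have ha : a ∈ A := huA (by simpa using ha)
        have hr0 : 0 < r a := hδ.trans_le (hδr a ha)
        have hd : ediam (closedBall (x a) (5 * r a)) ≤ ENNReal.ofReal (10 * r a) :=
          Metric.ediam_le_of_forall_dist_le fun y hy z hz => by
            linarith [dist_triangle_right y z (x a), mem_closedBall.1 hy, mem_closedBall.1 hz]
        have hd' : ediam (closedBall (x a) (5 * r a)) ≤ ENNReal.ofReal ρ :=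
          hd.trans (ENNReal.ofReal_le_ofReal (by linarith [hrρ a ha]))
        refine (hO _ hd').trans ((ENNReal.rpow_le_rpow hd hs).trans ?_)
        rw [ENNReal.ofReal_rpow_of_nonneg (by positivity) hs]
        refine ENNReal.ofReal_le_ofReal ?_
        have h1 := hbig a ha
        rw [Real.div_rpow hr0.le hδ.le, div_le_iff₀ (Real.rpow_pos_of_pos hδ s)] at h1
        rw [Real.mul_rpow (by norm_num) hr0.le]
        have h2 : (0 : ℝ) ≤ 10 ^ s := by positivity
        nlinarith
    _ = ENNReal.ofReal (2 * 10 ^ s * δ ^ s *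
          ∑ a ∈ hufin.toFinset, (((P : Set X) ∩ closedBall (x a) (r a)).ncard : ℝ)) := by
        rw [Finset.mul_sum, ENNReal.ofReal_sum_of_nonneg]
        intro a _
        positivity
    _ ≤ _ := by
        refine ENNReal.ofReal_le_ofReal ?_
        have : ∑ a ∈ hufin.toFinset, (((P : Set X) ∩ closedBall (x a) (r a)).ncard : ℝ) ≤ P.card := by
          exact_mod_cast hsum
        gcongr

open MeasureTheory Metric Set Filter Topology in
/-- Frostman's lemma for compact sets. -/
theorem exists_frostman_measure {X : Type*} [MetricSpace X] [MeasurableSpace X] [BorelSpace X]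
    {K : Set X} (hK : IsCompact K) {s : ℝ} (hs : 0 ≤ s) (h : ENNReal.ofReal s < dimH K) :
    ∃ μ : Measure X, IsProbabilityMeasure μ ∧ μ Kᶜ = 0 ∧ ∃ C : ℝ, 0 < C ∧
      ∀ x r, 0 < r → μ (closedBall x r) ≤ ENNReal.ofReal (C * r ^ s) := by
  classical
  obtain ⟨O, ρ, hρ, hOK, hO⟩ := exists_outerMeasure_of_lt_dimH hs h
  let δ : ℕ → ℝ := fun n => ρ / 10 / (n + 1)
  have hδ : ∀ n, 0 < δ n := fun n => by positivity
  have hδρ : ∀ n, δ n ≤ ρ / 10 := fun n =>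
    div_le_self (by positivity) (by linarith [(Nat.cast_nonneg n : (0 : ℝ) ≤ n)])
  choose P hPK hP hPcard using fun n =>
    exists_finset_frostman hO hK.totallyBounded hs (hδ n) (hδρ n)
  have hOK' : O K ≠ ∞ := ne_top_of_le_ne_top ENNReal.ofReal_ne_top (hPcard 0)
  set τ := (O K).toReal with hτ
  have hτ0 : 0 < τ := ENNReal.toReal_pos hOK hOK'
  have hcard : ∀ n, τ ≤ 2 * 10 ^ s * δ n ^ s * (P n).card := fun n =>
    ENNReal.toReal_le_of_le_ofReal (by have := hδ n; positivity) (hPcard n)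
  have hPne : ∀ n, (P n).Nonempty := by
    intro n
    rw [Finset.nonempty_iff_ne_empty]
    intro h0
    have := hcard n
    rw [h0] at this
    simp at this
    linarith
  let ν : ℕ → ProbabilityMeasure X := fun n =>
    ⟨(PMF.uniformOfFinset (P n) (hPne n)).toMeasure, inferInstance⟩
  -- The first summand serves radii up to `ρ / 10`, through the lower bound on the cardinality of `P
  -- n`; the second makes the bound at least `1` for larger radii.
  set C : ℝ := 2 * 10 ^ s / τ + (ρ / 10)⁻¹ ^ s with hC
  have hC1 : 0 ≤ 2 * 10 ^ s / τ := by positivity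
  have hC2 : 0 < (ρ / 10)⁻¹ ^ s := Real.rpow_pos_of_pos (by positivity) s
  have hC0 : 0 < C := by positivity
  have hball : ∀ n x r, δ n ≤ r → (ν n : Measure X) (closedBall x r) ≤ ENNReal.ofReal (C * r ^ s) := by
    intro n x r hr
    have hr0 : 0 < r := (hδ n).trans_le hr
    have hrs : 0 < r ^ s := Real.rpow_pos_of_pos hr0 s
    by_cases hrρ : r ≤ ρ / 10
    · have h1 : (ν n : Measure X) (closedBall x r) =
          ((P n).filter (· ∈ closedBall x r)).card / (P n).card :=
        PMF.toMeasure_uniformOfFinset_apply _ _ isClosed_closedBall.measurableSet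
      have h2 : ((P n).filter (· ∈ closedBall x r)).card =
          ((P n : Set X) ∩ closedBall x r).ncard := by
        rw [← Set.ncard_coe_finset]
        congr 1
        ext z
        simp
      have hc0 : (0 : ℝ) < (P n).card := by exact_mod_cast (hPne n).card_pos
      have h3 := hP n x r hr hrρ
      rw [h1, h2, ← ENNReal.ofReal_natCast, ← ENNReal.ofReal_natCast,
        ← ENNReal.ofReal_div_of_pos hc0]
      refine ENNReal.ofReal_le_ofReal ?_
      rw [div_le_iff₀ hc0]
      rw [Real.div_rpow hr0.le (hδ n).le] at h3
      have hδs : 0 < δ n ^ s := Real.rpow_pos_of_pos (hδ n) s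
      refine h3.trans ?_
      rw [div_le_iff₀ hδs]
      have h4 := hcard n
      have h5 : 1 ≤ 2 * 10 ^ s / τ * δ n ^ s * (P n).card := by
        rw [div_mul_eq_mul_div, div_mul_eq_mul_div, le_div_iff₀ hτ0]
        linarith
      have h6 : 2 * 10 ^ s / τ * δ n ^ s * (P n).card ≤ C * δ n ^ s * (P n).card := by
        gcongr
        linarith
      calc r ^ s = r ^ s * 1 := by ring
        _ ≤ r ^ s * (C * δ n ^ s * (P n).card) := by gcongr; linarith
        _ = _ := by ring
    · refine prob_le_one.trans ?_
      rw [← ENNReal.ofReal_one]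
      refine ENNReal.ofReal_le_ofReal ?_
      have h1 : 1 ≤ (ρ / 10)⁻¹ ^ s * r ^ s := by
        rw [← Real.mul_rpow (by positivity) hr0.le]
        refine Real.one_le_rpow ?_ hs
        rw [inv_mul_eq_div, one_le_div (by positivity)]
        linarith
      nlinarith
  have hνK : ∀ n, (ν n : Measure X) Kᶜ = 0 := by
    intro n
    change (PMF.uniformOfFinset (P n) (hPne n)).toMeasure Kᶜ = 0
    rw [PMF.toMeasure_apply_eq_zero_iff _ hK.isClosed.measurableSet.compl,
      PMF.support_uniformOfFinset, Set.disjoint_compl_right_iff_subset]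
    exact hPK n
  -- All `ν n` are carried by the single compact set `K`, so tightness holds with `u = 0`.
  have hcomp := isCompact_setOfPred_probabilityMeasure_mass_eq_compl_isCompact_le
    (E := X) (u := fun _ => 0) (K := fun _ => K) tendsto_const_nhds (fun _ => hK)
    (Or.inr monotone_const)
  obtain ⟨m, hm, hlim⟩ := hcomp.ultrafilter_le_nhds' (Ultrafilter.map ν (hyperfilter ℕ)) (by
    refine Filter.Eventually.of_forall (f := (hyperfilter ℕ : Filter ℕ)) fun n _ => ?_
    have := hνK n
    rw [← ENNReal.coe_le_coe, ProbabilityMeasure.ennreal_coeFn_eq_coeFn_toMeasure, this]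
    simp)
  have hlim' : Tendsto ν (hyperfilter ℕ) (𝓝 m) := hlim
  refine ⟨m, inferInstance, ?_, C * 2 ^ s, by positivity, fun x r hr => ?_⟩
  · have := hm 0
    rw [← ProbabilityMeasure.ennreal_coeFn_eq_coeFn_toMeasure]
    exact_mod_cast le_antisymm this bot_le
  -- Mass passes to the limit in the needed direction only on open sets; doubling the radius costs
  -- the factor `2 ^ s`.
  · have h1 : (m : Measure X) (closedBall x r) ≤ (m : Measure X) (ball x (2 * r)) :=
      measure_mono (closedBall_subset_ball (by linarith))
    refine h1.trans ((ProbabilityMeasure.le_liminf_measure_open_of_tendsto hlim' isOpen_ball).trans ?_)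
    refine (liminf_le_limsup).trans (limsup_le_of_le (by isBoundedDefault) ?_)
    have hδlim : Tendsto δ atTop (𝓝 0) := by
      have := (tendsto_one_div_add_atTop_nhds_zero_nat (𝕜 := ℝ)).const_mul (ρ / 10)
      simpa [δ, div_eq_mul_inv] using this
    have hev : ∀ᶠ n in (hyperfilter ℕ : Filter ℕ), δ n < 2 * r := by
      have := hδlim.eventually_lt_const (show (0 : ℝ) < 2 * r by positivity)
      exact Nat.hyperfilter_le_atTop this
    filter_upwards [hev] with n hn
    refine (measure_mono ball_subset_closedBall).trans ((hball n x (2 * r) hn.le).trans ?_)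
    rw [Real.mul_rpow (by norm_num) hr.le]
    exact ENNReal.ofReal_le_ofReal (by rw [mul_assoc])

/-! ### Lines through a point and the metric on lines. -/

namespace PlaneLine

/-- The line through `x` in the direction `e`. -/
noncomputable def throughDir (x e : Plane) (he : e ≠ 0) : PlaneLine where
  carrier := AffineSubspace.mk' x (Submodule.span ℝ {e})
  nonempty := ⟨x, AffineSubspace.self_mem_mk' _ _⟩
  finrank_direction := by rw [AffineSubspace.direction_mk']; exact finrank_span_singleton he

theorem mem_throughDir (x e : Plane) (he : e ≠ 0) : x ∈ (throughDir x e he).carrier :=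
  AffineSubspace.self_mem_mk' _ _

theorem dirProj_throughDir (x e : Plane) (he : e ≠ 0) :
    (throughDir x e he).dirProj = (Submodule.span ℝ {e}).starProjection := by
  unfold dirProj
  have : (throughDir x e he).carrier.direction = Submodule.span ℝ {e} :=
    AffineSubspace.direction_mk' _ _
  exact Submodule.starProjection_inj.mpr this

theorem dirProj_throughDir_apply (x e : Plane) (he : e ≠ 0) (h1 : ‖e‖ = 1) (p : Plane) :
    (throughDir x e he).dirProj p = inner ℝ e p • e := by
  rw [dirProj_throughDir, Submodule.starProjection_unit_singleton ℝ h1]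

theorem foot_eq (l : PlaneLine) {x : Plane} (hx : x ∈ l.carrier) :
    l.foot = x - l.dirProj x := by
  refine l.exists_foot.unique ⟨l.foot_mem, l.foot_mem_orthogonal⟩ ⟨?_, ?_⟩
  · have h : -(l.carrier.direction.starProjection x) ∈ l.carrier.direction :=
      neg_mem (Submodule.starProjection_apply_mem _ x)
    have := AffineSubspace.vadd_mem_of_mem_direction h hx
    simpa [sub_eq_add_neg, add_comm, dirProj] using this
  · exact Submodule.sub_starProjection_mem_orthogonal x

theorem dist_def (l₁ l₂ : PlaneLine) :
    dist l₁ l₂ = ‖l₁.dirProj - l₂.dirProj‖ + ‖l₁.foot - l₂.foot‖ := rfl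

/-- Each foot is `x - π x`, so the feet differ by the difference of the projections applied to `x`:
the direction part controls the whole metric. -/
theorem dist_le_of_mem {l₁ l₂ : PlaneLine} {x : Plane} (h₁ : x ∈ l₁.carrier)
    (h₂ : x ∈ l₂.carrier) : dist l₁ l₂ ≤ (1 + ‖x‖) * ‖l₁.dirProj - l₂.dirProj‖ := by
  have h : l₁.foot - l₂.foot = -((l₁.dirProj - l₂.dirProj) x) := by
    rw [foot_eq l₁ h₁, foot_eq l₂ h₂, sub_apply]
    abel
  have := (l₁.dirProj - l₂.dirProj).le_opNorm x
  rw [dist_def, h, norm_neg]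
  linarith

theorem dist_throughDir_le (x : Plane) {e e' : Plane} (he : e ≠ 0) (he' : e' ≠ 0)
    (h1 : ‖e‖ = 1) (h1' : ‖e'‖ = 1) :
    dist (throughDir x e he) (throughDir x e' he') ≤ (1 + ‖x‖) * (2 * ‖e - e'‖) := by
  refine (dist_le_of_mem (mem_throughDir x e he) (mem_throughDir x e' he')).trans ?_
  refine mul_le_mul_of_nonneg_left ?_ (by positivity)
  refine ContinuousLinearMap.opNorm_le_bound _ (by positivity) fun p => ?_
  have h : ((throughDir x e he).dirProj - (throughDir x e' he').dirProj) p =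
      inner ℝ e p • (e - e') + inner ℝ (e - e') p • e' := by
    rw [sub_apply, dirProj_throughDir_apply _ _ _ h1,
      dirProj_throughDir_apply _ _ _ h1', inner_sub_left, smul_sub, sub_smul]
    abel
  rw [h]
  have h2 := norm_inner_le_norm (𝕜 := ℝ) e p
  have h3 := norm_inner_le_norm (𝕜 := ℝ) (e - e') p
  rw [h1, one_mul] at h2
  calc _ ≤ ‖inner ℝ e p • (e - e')‖ + ‖inner ℝ (e - e') p • e'‖ := norm_add_le _ _
    _ = ‖inner ℝ e p‖ * ‖e - e'‖ + ‖inner ℝ (e - e') p‖ := by rw [norm_smul, norm_smul, h1', mul_one]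
    _ ≤ ‖p‖ * ‖e - e'‖ + ‖e - e'‖ * ‖p‖ := by gcongr
    _ = _ := by ring

/-- If two lines meet at `x`, a point `y` of the first is at distance at most
`dist l₁ l₂ * ‖y - x‖` from the second. -/
theorem infDist_le_of_mem {l₁ l₂ : PlaneLine} {x y : Plane} (hx₁ : x ∈ l₁.carrier)
    (hx₂ : x ∈ l₂.carrier) (hy : y ∈ l₁.carrier) :
    Metric.infDist y (l₂.carrier : Set Plane) ≤ dist l₁ l₂ * ‖y - x‖ := by
  have h1 : l₁.dirProj (y - x) = y - x := by
    refine Submodule.starProjection_eq_self_iff.2 ?_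
    exact AffineSubspace.vsub_mem_direction hy hx₁
  have hz : l₂.dirProj (y - x) + x ∈ l₂.carrier :=
    AffineSubspace.vadd_mem_of_mem_direction (Submodule.starProjection_apply_mem _ _) hx₂
  refine (Metric.infDist_le_dist_of_mem hz).trans ?_
  have h2 : y - (l₂.dirProj (y - x) + x) = (l₁.dirProj - l₂.dirProj) (y - x) := by
    rw [sub_apply, h1]
    abel
  rw [dist_eq_norm, h2]
  refine ((l₁.dirProj - l₂.dirProj).le_opNorm _).trans ?_
  refine mul_le_mul_of_nonneg_right ?_ (norm_nonneg _)
  rw [dist_def]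
  linarith [norm_nonneg (l₁.foot - l₂.foot)]

open Classical in
/-- The line through `x` and `y`. For `y = x` it is some line through `x`. -/
noncomputable def join (x y : Plane) : PlaneLine :=
  if h : radialProj x y ≠ 0 then throughDir x (radialProj x y) h
  else throughDir x (EuclideanSpace.single 0 1) (by simp)

theorem mem_join_left (x y : Plane) : x ∈ (join x y).carrier := by
  unfold join
  split_ifs <;> exact mem_throughDir _ _ _

end PlaneLine

theorem norm_radialProj {x y : Plane} (h : y ≠ x) : ‖radialProj x y‖ = 1 := by
  have : ‖y - x‖ ≠ 0 := norm_ne_zero_iff.2 (sub_ne_zero.2 h)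
  rw [radialProj, norm_smul, norm_inv, norm_norm, inv_mul_cancel₀ this]

theorem radialProj_ne_zero {x y : Plane} (h : y ≠ x) : radialProj x y ≠ 0 := by
  rw [← norm_ne_zero_iff, norm_radialProj h]
  exact one_ne_zero

namespace PlaneLine

theorem join_of_ne {x y : Plane} (h : y ≠ x) :
    join x y = throughDir x (radialProj x y) (radialProj_ne_zero h) :=
  dif_pos (radialProj_ne_zero h)

theorem mem_join_right (x y : Plane) : y ∈ (join x y).carrier := by
  by_cases h : y = x
  · subst h
    exact mem_join_left _ _
  rw [join_of_ne h]
  refine (AffineSubspace.mem_mk' ..).2 (Submodule.mem_span_singleton.2 ⟨‖y - x‖, ?_⟩)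
  have : ‖y - x‖ ≠ 0 := norm_ne_zero_iff.2 (sub_ne_zero.2 h)
  rw [radialProj, smul_smul, mul_inv_cancel₀ this, one_smul]
  rfl

theorem dist_join_le {x y z : Plane} (hy : y ≠ x) (hz : z ≠ x) :
    dist (join x y) (join x z) ≤
      2 * (1 + ‖x‖) * dist (radialProj x y) (radialProj x z) := by
  rw [join_of_ne hy, join_of_ne hz, dist_eq_norm]
  refine (dist_throughDir_le x _ _ (norm_radialProj hy) (norm_radialProj hz)).trans (le_of_eq ?_)
  ring

theorem continuousOn_join {x : Plane} {K : Set Plane} (hx : x ∉ K) :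
    ContinuousOn (join x) K := by
  have hne : ∀ y ∈ K, y ≠ x := fun y hy h => hx (h ▸ hy)
  have hrad : ContinuousOn (radialProj x) K := by
    have h1 : ContinuousOn (fun y => ‖y - x‖) K := by fun_prop
    have h2 : ContinuousOn (fun y => y - x) K := by fun_prop
    refine (h1.inv₀ fun y hy => ?_).smul h2
    exact norm_ne_zero_iff.2 (sub_ne_zero.2 (hne y hy))
  intro y hy
  rw [ContinuousWithinAt, tendsto_iff_dist_tendsto_zero]
  have h1 := (tendsto_iff_dist_tendsto_zero.1 (hrad y hy)).const_mul (2 * (1 + ‖x‖))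
  rw [mul_zero] at h1
  refine squeeze_zero' (Filter.Eventually.of_forall fun _ => dist_nonneg) ?_ h1
  filter_upwards [self_mem_nhdsWithin] with z hz
  exact dist_join_le (hne z hz) (hne y hy)

/-- The map `join x` factors through `radialProj x` and `e ↦ join x (x + e)`, which is Lipschitz on
unit vectors. -/
theorem dimH_image_join_le {x : Plane} {K : Set Plane} (hx : x ∉ K) :
    dimH (join x '' K) ≤ dimH (radialProj x '' K) := by
  have hne : ∀ y ∈ K, y ≠ x := fun y hy h => hx (h ▸ hy)
  have hL : LipschitzOnWith (2 * (1 + ‖x‖₊))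
      (fun e => join x (x + e)) (radialProj x '' K) := by
    refine LipschitzOnWith.of_dist_le_mul ?_
    rintro _ ⟨y, hy, rfl⟩ _ ⟨z, hz, rfl⟩
    have hr : ∀ y ∈ K, radialProj x (x + radialProj x y) = radialProj x y := by
      intro y hy
      conv_lhs => rw [radialProj]
      rw [add_sub_cancel_left, norm_radialProj (hne y hy), inv_one, one_smul]
    have hn : ∀ y ∈ K, x + radialProj x y ≠ x := fun y hy h =>
      radialProj_ne_zero (hne y hy) (by simpa using h)
    have := dist_join_le (hn y hy) (hn z hz)
    rw [hr y hy, hr z hz] at this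
    simpa using this
  refine le_trans (le_of_eq ?_) hL.dimH_image_le
  congr 1
  rw [Set.image_image]
  refine Set.image_congr fun y hy => ?_
  have hr : radialProj x (x + radialProj x y) = radialProj x y := by
    conv_lhs => rw [radialProj]
    rw [add_sub_cancel_left, norm_radialProj (hne y hy), inv_one, one_smul]
  have hn : x + radialProj x y ≠ x := fun h =>
    radialProj_ne_zero (hne y hy) (by simpa using h)
  rw [join_of_ne (hne y hy), join_of_ne hn]
  simp only [hr]

end PlaneLine

/-! ### Comparing masses with packing and covering numbers. -/

section MassCounting

variable {X Y : Type*} [MeasurableSpace X] [MetricSpace Y]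

open MeasureTheory Metric Set in
theorem measurableSet_inter_preimage_closedBall [TopologicalSpace X] [BorelSpace X] {K : Set X} {f : X → Y} (hK : IsClosed K)
    (hf : ContinuousOn f K) (y : Y) (r : ℝ) : MeasurableSet (K ∩ f ⁻¹' closedBall y r) :=
  (hf.preimage_isClosed_of_isClosed hK isClosed_closedBall).measurableSet

open MeasureTheory Metric Set in
/-- An `r`-separated set of centres of balls of radius `r / 2` and of mass at least `a`, all
inside a set of mass at most `w`, has at most `w / a` elements. -/
theorem packingNumber_le_of_measure_le [TopologicalSpace X] [BorelSpace X]
    {μ : Measure X} {K W : Set X} {f : X → Y} {V : Set Y}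
    {r a w : ℝ} (hK : IsClosed K) (hf : ContinuousOn f K) (hr : 0 < r) (ha : 0 < a) (hw : 0 ≤ w)
    (hV : ∀ v ∈ V, ENNReal.ofReal a ≤ μ (K ∩ f ⁻¹' closedBall v (r / 2)))
    (hVW : ∀ v ∈ V, K ∩ f ⁻¹' closedBall v (r / 2) ⊆ W) (hW : μ W ≤ ENNReal.ofReal w) :
    (packingNumber r.toNNReal V : ℝ≥0∞) ≤ ENNReal.ofReal (w / a) := by
  classical
  have hfin : ∀ F : Finset Y, ↑F ⊆ V → IsSeparated (r.toNNReal : ℝ≥0∞) (F : Set Y) →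
      F.card ≤ ⌊w / a⌋₊ := by
    intro F hF hsep
    refine Nat.le_floor ((le_div_iff₀ ha).2 ?_)
    have hdisj : (F : Set Y).PairwiseDisjoint fun v => K ∩ f ⁻¹' closedBall v (r / 2) := by
      intro u hu v hv huv
      refine Set.disjoint_left.2 fun z hz hz' => ?_
      have h1 : (r.toNNReal : ℝ≥0∞) < edist u v := hsep hu hv huv
      rw [edist_dist] at h1
      have h2 : r < dist u v := (ENNReal.ofReal_lt_ofReal_iff_of_nonneg hr.le).1 h1
      linarith [dist_triangle_left u v (f z), mem_closedBall.1 hz.2, mem_closedBall.1 hz'.2]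
    have h1 : μ (⋃ v ∈ F, K ∩ f ⁻¹' closedBall v (r / 2)) =
        ∑ v ∈ F, μ (K ∩ f ⁻¹' closedBall v (r / 2)) :=
      measure_biUnion_finset hdisj fun v _ => measurableSet_inter_preimage_closedBall hK hf v _
    have h2 : ∑ _v ∈ F, ENNReal.ofReal a ≤ ENNReal.ofReal w :=
      calc _ ≤ ∑ v ∈ F, μ (K ∩ f ⁻¹' closedBall v (r / 2)) :=
            Finset.sum_le_sum fun v hv => hV v (hF hv)
        _ ≤ μ W := by rw [← h1]; exact measure_mono (iUnion₂_subset fun v hv => hVW v (hF hv))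
        _ ≤ _ := hW
    rw [Finset.sum_const, nsmul_eq_mul, ← ENNReal.ofReal_natCast,
      ← ENNReal.ofReal_mul (by positivity)] at h2
    exact (ENNReal.ofReal_le_ofReal_iff hw).1 h2
  -- A separated set may be infinite a priori, so a finite subset with one point too many is
  -- extracted.
  have hpack : packingNumber r.toNNReal V ≤ (⌊w / a⌋₊ : ℕ∞) := by
    refine iSup_le fun C => iSup₂_le fun hCV hC => ?_
    by_contra hlt
    have hle : ((⌊w / a⌋₊ + 1 : ℕ) : ℕ∞) ≤ C.encard := by
      push_cast
      exact Order.add_one_le_of_lt (not_le.1 hlt)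
    obtain ⟨t, htC, ht⟩ := Set.exists_subset_encard_eq hle
    have htfin : t.Finite := Set.finite_of_encard_eq_coe ht
    have := hfin htfin.toFinset (by simpa using htC.trans hCV) (by simpa using hC.subset htC)
    rw [htfin.encard_eq_coe_toFinset_card] at ht
    have ht' : htfin.toFinset.card = ⌊w / a⌋₊ + 1 := by exact_mod_cast ht
    omega
  calc (packingNumber r.toNNReal V : ℝ≥0∞) ≤ ((⌊w / a⌋₊ : ℕ∞) : ℝ≥0∞) :=
        ENat.toENNReal_le.2 hpack
    _ = ENNReal.ofReal (⌊w / a⌋₊ : ℝ) := by simp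
    _ ≤ _ := ENNReal.ofReal_le_ofReal (Nat.floor_le (by positivity))

open MeasureTheory Metric Set in
theorem measure_le_encard_mul_of_isCover {μ : Measure X} {D : Set X} {f : X → Y} {C : Set Y}
    {r : ℝ} {b : ℝ≥0∞} (hr : 0 ≤ r) (hC : C.Finite) (hcov : IsCover r.toNNReal (f '' D) C)
    (hb : ∀ z ∈ C, μ (D ∩ f ⁻¹' closedBall z r) ≤ b) : μ D ≤ (C.encard : ℝ≥0∞) * b := by
  rw [isCover_iff_subset_iUnion_closedBall, Real.coe_toNNReal r hr] at hcov
  have hsub : D ⊆ ⋃ z ∈ hC.toFinset, D ∩ f ⁻¹' closedBall z r := by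
    intro x hx
    obtain ⟨z, hz, hxz⟩ := mem_iUnion₂.1 (hcov (mem_image_of_mem f hx))
    exact mem_biUnion (by simpa using hz) ⟨hx, hxz⟩
  calc μ D ≤ ∑ z ∈ hC.toFinset, μ (D ∩ f ⁻¹' closedBall z r) :=
        (measure_mono hsub).trans (measure_biUnion_finset_le _ _)
    _ ≤ ∑ _z ∈ hC.toFinset, b := Finset.sum_le_sum fun z hz => hb z (by simpa using hz)
    _ = _ := by rw [Finset.sum_const, nsmul_eq_mul, hC.encard_eq_coe_toFinset_card]; simp

open MeasureTheory Metric Set in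
-- An internal cover has its centres in `f '' D`, so balls need to be controlled only there.
theorem measure_le_coveringNumber_mul {μ : Measure X} {D : Set X} {f : X → Y}
    {r : ℝ} {b : ℝ≥0∞} (hr : 0 ≤ r) (hfin : coveringNumber r.toNNReal (f '' D) ≠ ⊤)
    (hb : ∀ z ∈ D, μ (D ∩ f ⁻¹' closedBall (f z) r) ≤ b) :
    μ D ≤ (coveringNumber r.toNNReal (f '' D) : ℝ≥0∞) * b := by
  obtain ⟨C, hCsub, hCfin, hC, hcard⟩ := exists_set_encard_eq_coveringNumber hfin
  rw [← hcard]
  refine measure_le_encard_mul_of_isCover hr hCfin hC fun z hz => ?_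
  obtain ⟨x, hx, rfl⟩ := hCsub hz
  exact hb x hx

open MeasureTheory Metric Set in
theorem measure_le_ballCoveringNumber_mul {μ : Measure X} {D : Set X} {f : X → Y}
    {r : ℝ} {b : ℝ≥0∞} (hr : 0 ≤ r) (hfin : ballCoveringNumber r (f '' D) ≠ ⊤)
    (hb : ∀ z, μ (D ∩ f ⁻¹' closedBall z r) ≤ b) :
    μ D ≤ (ballCoveringNumber r (f '' D) : ℝ≥0∞) * b := by
  unfold ballCoveringNumber at *
  simp only [externalCoveringNumber, ne_eq, iInf_eq_top, encard_eq_top_iff, not_forall,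
    not_infinite] at hfin
  obtain ⟨C', hC', hC'fin⟩ := hfin
  have : Nonempty {s : Set Y // IsCover r.toNNReal (f '' D) s} := ⟨C', hC'⟩
  obtain ⟨C, hC⟩ := ENat.exists_eq_iInf
    (fun C : {s : Set Y // IsCover r.toNNReal (f '' D) s} => (C : Set Y).encard)
  have hCe : (C : Set Y).encard = externalCoveringNumber r.toNNReal (f '' D) := by
    rw [hC, iInf_subtype]
    rfl
  have hCfin : (C : Set Y).Finite := by
    refine Set.encard_lt_top_iff.mp (lt_of_le_of_lt ?_ hC'fin.encard_lt_top)
    rw [hCe]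
    exact hC'.externalCoveringNumber_le_encard
  rw [← hCe]
  exact measure_le_encard_mul_of_isCover hr hCfin C.2 fun z _ => hb z

end MassCounting

/-! ### A Borel–Cantelli argument for measures and outer measures. -/

open MeasureTheory Filter Set in
/-- A set of positive mass, almost all of whose points lie in infinitely many of the sets `M k`,
forces infinitely many `M k` to have more mass than the terms of a given convergent series. -/
theorem exists_lt_measure_of_frequently {α F : Type*} [FunLike F (Set α) ℝ≥0∞]
    [OuterMeasureClass F α] {μ : F} {A N : Set α} {M : ℕ → Set α} {b : ℕ → ℝ≥0∞}
    (hA : μ A ≠ 0) (hN : μ N = 0) (hAM : ∀ x ∈ A, x ∈ N ∨ ∀ k₀, ∃ k ≥ k₀, x ∈ M k)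
    (hb : ∑' k, b k ≠ ∞) (k₀ : ℕ) : ∃ k ≥ k₀, b k < μ (M k) := by
  classical
  by_contra! hcon
  let M' : ℕ → Set α := fun k => if k₀ ≤ k then M k else ∅
  have h1 : ∑' k, μ (M' k) ≠ ∞ := by
    refine ne_top_of_le_ne_top hb (ENNReal.tsum_le_tsum fun k => ?_)
    by_cases hk : k₀ ≤ k
    · simpa only [M', if_pos hk] using hcon k hk
    · simp [M', if_neg hk]
  have h2 := measure_limsup_atTop_eq_zero h1
  refine hA (measure_mono_null (t := N ∪ limsup M' atTop) ?_ (measure_union_null hN h2))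
  intro x hx
  refine (hAM x hx).imp id fun h => ?_
  rw [mem_limsup_iff_frequently_mem, frequently_atTop]
  intro k₁
  obtain ⟨k, hk, hxk⟩ := h (max k₀ k₁)
  exact ⟨k, (le_max_right _ _).trans hk, by simpa only [M', if_pos ((le_max_left _ _).trans hk)] using hxk⟩

/-! ### Local dimension of the image measure. -/

section RegularPart

variable {X Y : Type*} [MeasurableSpace X] [MetricSpace Y]

open MeasureTheory Metric Set in
/-- The points `y` of `K` for which the balls around `f y` of radius `r ≤ 1 / (n + 1)` have
mass at most `r ^ d` with respect to the image under `f` of the restriction of `μ` to `K`. -/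
def regularPart (μ : Measure X) (K : Set X) (f : X → Y) (d : ℝ) (n : ℕ) : Set X :=
  {y | y ∈ K ∧ ∀ r, 0 < r → r ≤ 1 / ((n : ℝ) + 1) →
    μ (K ∩ f ⁻¹' closedBall (f y) r) ≤ ENNReal.ofReal (r ^ d)}

open MeasureTheory Metric Set Filter Topology in
-- Mass distribution principle: the image of `μ` restricted to the regular part is dominated by
-- `μH[σ]`, which vanishes on `f '' K`. Outer measures are used because the regular part need not be
-- measurable.
theorem measure_regularPart_eq_zero {μ : Measure X} {K : Set X} {f : X → Y} {σ : ℝ}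
    (hσ : 0 < σ) (h : dimH (f '' K) < ENNReal.ofReal σ) (n : ℕ) :
    μ (regularPart μ K f σ n) = 0 := by
  borelize Y
  set A := regularPart μ K f σ n with hA
  have hAK : A ⊆ K := fun y hy => hy.1
  have hn : (0 : ℝ) < 1 / ((n : ℝ) + 1) := by positivity
  set lam : OuterMeasure Y := OuterMeasure.map f (OuterMeasure.restrict A μ.toOuterMeasure)
  have hlam : ∀ S, lam S = μ (f ⁻¹' S ∩ A) := by
    intro S
    rw [OuterMeasure.map_apply, OuterMeasure.restrict_apply]
    rfl
  have h1 : lam ≤ OuterMeasure.mkMetric fun r => r ^ σ := by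
    refine OuterMeasure.le_mkMetric _ _ (ENNReal.ofReal (1 / ((n : ℝ) + 1)))
      (ENNReal.ofReal_pos.2 hn) fun S hS => ?_
    rw [hlam]
    rcases (f ⁻¹' S ∩ A).eq_empty_or_nonempty with h0 | ⟨y, hyS, hyA⟩
    · simp [h0]
    have hSfin : ediam S ≠ ∞ := ne_top_of_le_ne_top ENNReal.ofReal_ne_top hS
    have hD : diam S ≤ 1 / ((n : ℝ) + 1) := ENNReal.toReal_le_of_le_ofReal hn.le hS
    have hbd : Bornology.IsBounded S := isBounded_iff_ediam_ne_top.2 hSfin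
    have key : ∀ r, 0 < r → diam S ≤ r → r ≤ 1 / ((n : ℝ) + 1) →
        μ (f ⁻¹' S ∩ A) ≤ ENNReal.ofReal (r ^ σ) := by
      intro r hr hdr hrn
      refine le_trans (measure_mono ?_) (hyA.2 r hr hrn)
      rintro z ⟨hzS, hzA⟩
      exact ⟨hAK hzA, (dist_le_diam_of_mem hbd hzS hyS).trans hdr⟩
    -- Regularity speaks only of positive radii; for zero diameter, `r → 0` and `σ > 0` give mass
    -- zero.
    rcases eq_or_lt_of_le (diam_nonneg (s := S)) with h0 | h0
    · have h2 : μ (f ⁻¹' S ∩ A) ≤ 0 := by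
        have hlim : Tendsto (fun r : ℝ => ENNReal.ofReal (r ^ σ)) (𝓝[>] 0) (𝓝 0) := by
          have h3 : Tendsto (fun r : ℝ => r ^ σ) (𝓝[>] 0) (𝓝 0) := by
            have := (Real.continuousAt_rpow_const 0 σ (Or.inr hσ.le)).tendsto
            rw [Real.zero_rpow hσ.ne'] at this
            exact this.mono_left nhdsWithin_le_nhds
          simpa using ENNReal.tendsto_ofReal h3
        refine ge_of_tendsto hlim ?_
        filter_upwards [Ioc_mem_nhdsGT hn] with r hr
        exact key r hr.1 (h0 ▸ hr.1.le) hr.2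
      exact h2.trans bot_le
    · refine (key _ h0 le_rfl hD).trans (le_of_eq ?_)
      rw [← ENNReal.ofReal_rpow_of_nonneg diam_nonneg hσ.le, diam, ENNReal.ofReal_toReal hSfin]
  have h2 : μH[σ] (f '' K) = 0 := by
    have := hausdorffMeasure_of_dimH_lt (s := f '' K) (d := σ.toNNReal) h
    rwa [Real.coe_toNNReal _ hσ.le] at this
  have h3 : lam (f '' K) ≤ 0 := by
    rw [← h2, Measure.hausdorffMeasure, ← OuterMeasure.coe_mkMetric]
    exact h1 _
  refine le_antisymm (le_trans (measure_mono fun y hy => ?_) (hlam (f '' K) ▸ h3)) bot_le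
  exact ⟨mem_image_of_mem f (hAK hy), hy⟩

open MeasureTheory Metric Set in
theorem regularPart_anti {μ : Measure X} {K : Set X} {f : X → Y} {d d' : ℝ} (h : d ≤ d') (n : ℕ) :
    regularPart μ K f d' n ⊆ regularPart μ K f d n := by
  refine fun y hy => ⟨hy.1, fun r hr hrn => (hy.2 r hr hrn).trans ?_⟩
  refine ENNReal.ofReal_le_ofReal (Real.rpow_le_rpow_of_exponent_ge hr (hrn.trans ?_) h)
  rw [div_le_one (by positivity)]
  linarith [(Nat.cast_nonneg n : (0 : ℝ) ≤ n)]

open MeasureTheory Metric Set in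
/-- The exact dimension, up to `η`, of the image of some part of `μ`. -/
theorem exists_measure_regularPart_ne_zero {μ : Measure X} [IsProbabilityMeasure μ] {K : Set X}
    {f : X → Y} {σ η : ℝ} (hK : μ K ≠ 0) (hσ : 0 < σ) (hη : 0 < η)
    (h : dimH (f '' K) < ENNReal.ofReal σ) :
    ∃ i n : ℕ, i * η < σ ∧ μ (regularPart μ K f (i * η) n) ≠ 0 ∧
      ∀ m, μ (regularPart μ K f (i * η + η) m) = 0 := by
  classical
  have hlarge : ∀ i : ℕ, σ ≤ i * η → ∀ n, μ (regularPart μ K f (i * η) n) = 0 := fun i hi n =>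
    measure_mono_null (regularPart_anti hi n) (measure_regularPart_eq_zero hσ h n)
  have hex : ∃ i : ℕ, ∀ n, μ (regularPart μ K f (i * η) n) = 0 := by
    obtain ⟨i, hi⟩ := exists_nat_gt (σ / η)
    exact ⟨i, hlarge i ((div_lt_iff₀ hη).1 hi).le⟩
  -- At exponent `0` the mass bound is `1`, so the regular part is all of `K`. The first null
  -- exponent thus has a predecessor.
  have h0 : Nat.find hex ≠ 0 := by
    intro h0
    have h1 := Nat.find_spec hex 0
    rw [h0] at h1
    refine hK (measure_mono_null (fun y hy => show y ∈ regularPart _ _ _ _ _ from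
      ⟨hy, fun r hr _ => ?_⟩) h1)
    simpa using prob_le_one
  obtain ⟨i, hi⟩ := Nat.exists_eq_succ_of_ne_zero h0
  have h1 : ¬ ∀ n, μ (regularPart μ K f (i * η) n) = 0 := Nat.find_min hex (by omega)
  have h2 := Nat.find_spec hex
  rw [hi] at h2
  obtain ⟨n, hn⟩ := not_forall.1 h1
  refine ⟨i, n, ?_, hn, fun m => ?_⟩
  · by_contra hge
    exact h1 (hlarge i (not_lt.1 hge))
  · have := h2 m
    rwa [Nat.succ_eq_add_one, Nat.cast_add_one, add_mul, one_mul] at this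

end RegularPart

/-! ### Grid squares and mass classes. -/

theorem sum_const_ofReal {ι : Type*} (T : Finset ι) {a : ℝ} (ha : 0 ≤ a) :
    ∑ _m ∈ T, ENNReal.ofReal a = ENNReal.ofReal (a * T.card) := by
  rw [Finset.sum_const, nsmul_eq_mul, mul_comm, ENNReal.ofReal_mul ha, ENNReal.ofReal_natCast]

/-- The index of the square of side length `a` that contains the given point. -/
noncomputable def squareIndex (a : ℝ) (y : Plane) : ℤ × ℤ := (⌊y 0 / a⌋, ⌊y 1 / a⌋)

theorem measurable_squareIndex (a : ℝ) : Measurable (squareIndex a) := by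
  unfold squareIndex
  fun_prop

theorem Plane.abs_apply_le_norm (y : Plane) (i : Fin 2) : |y i| ≤ ‖y‖ :=
  PiLp.norm_apply_le y i

theorem Plane.norm_le_abs_add_abs (y : Plane) : ‖y‖ ≤ |y 0| + |y 1| := by
  rw [EuclideanSpace.norm_eq, Fin.sum_univ_two, Real.sqrt_le_left (by positivity)]
  simp only [Real.norm_eq_abs]
  nlinarith [abs_nonneg (y 0), abs_nonneg (y 1)]

theorem abs_sub_le_of_floor_div_eq {a u v : ℝ} (ha : 0 < a) (h : ⌊u / a⌋ = ⌊v / a⌋) :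
    |u - v| ≤ a := by
  have := Int.abs_sub_lt_one_of_floor_eq_floor h
  rw [← sub_div, abs_div, abs_of_pos ha, div_lt_one ha] at this
  exact this.le

theorem dist_le_of_squareIndex_eq {a : ℝ} (ha : 0 < a) {y z : Plane}
    (h : squareIndex a y = squareIndex a z) : dist y z ≤ 2 * a := by
  rw [squareIndex, squareIndex, Prod.mk.injEq] at h
  have h0 := abs_sub_le_of_floor_div_eq ha h.1
  have h1 := abs_sub_le_of_floor_div_eq ha h.2
  rw [dist_eq_norm]
  have := Plane.norm_le_abs_add_abs (y - z)
  simp only [PiLp.sub_apply] at this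
  linarith

/-- Distinct congruent indices differ by at least `10`, and the floors lose less than `1`. With `a =
Δ / 4` the gap `9 * a` exceeds `2 * Δ`, so a `Δ`-ball meets at most one square of each colour. -/
theorem lt_abs_sub_of_floor_div {a u v : ℝ} (ha : 0 < a)
    (h : ((⌊u / a⌋ : ℤ) : ZMod 10) = ((⌊v / a⌋ : ℤ) : ZMod 10)) (hne : ⌊u / a⌋ ≠ ⌊v / a⌋) :
    9 * a < |u - v| := by
  rw [ZMod.intCast_eq_intCast_iff_dvd_sub] at h
  have h1 : (10 : ℤ) ≤ |⌊v / a⌋ - ⌊u / a⌋| :=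
    Int.le_of_dvd (abs_pos.2 (sub_ne_zero.2 hne.symm)) ((dvd_abs _ _).2 (by simpa using h))
  have h2 : (10 : ℝ) ≤ |(⌊v / a⌋ : ℝ) - ⌊u / a⌋| := by exact_mod_cast h1
  have h3 : |(⌊v / a⌋ : ℝ) - ⌊u / a⌋| < |u / a - v / a| + 1 := by
    have e1 := Int.floor_le (u / a)
    have e2 := Int.lt_floor_add_one (u / a)
    have e3 := Int.floor_le (v / a)
    have e4 := Int.lt_floor_add_one (v / a)
    rw [abs_lt]
    constructor
    · linarith [le_abs_self (u / a - v / a)]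
    · linarith [neg_abs_le (u / a - v / a)]
  rw [← sub_div, abs_div, abs_of_pos ha] at h3
  have h4 : 9 < |u - v| / a := by linarith
  rwa [lt_div_iff₀ ha] at h4

theorem lt_dist_of_squareIndex {a : ℝ} (ha : 0 < a) {y z : Plane}
    (h0 : ((squareIndex a y).1 : ZMod 10) = ((squareIndex a z).1 : ZMod 10))
    (h1 : ((squareIndex a y).2 : ZMod 10) = ((squareIndex a z).2 : ZMod 10))
    (hne : squareIndex a y ≠ squareIndex a z) : 9 * a < dist y z := by
  rw [dist_eq_norm]
  by_cases h : (squareIndex a y).1 = (squareIndex a z).1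
  · have h' : (squareIndex a y).2 ≠ (squareIndex a z).2 := fun h' => hne (Prod.ext h h')
    exact (lt_abs_sub_of_floor_div ha h1 h').trans_le (Plane.abs_apply_le_norm (y - z) 1)
  · exact (lt_abs_sub_of_floor_div ha h0 h).trans_le (Plane.abs_apply_le_norm (y - z) 0)

theorem squareIndex_mem {Δ : ℝ} (hΔ : 0 < Δ) {y : Plane} (hy : ‖y‖ ≤ 1) :
    squareIndex (Δ / 4) y ∈ Finset.Icc (-⌈4 / Δ⌉) ⌈4 / Δ⌉ ×ˢ Finset.Icc (-⌈4 / Δ⌉) ⌈4 / Δ⌉ := by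
  have key : ∀ i, ⌊y i / (Δ / 4)⌋ ∈ Finset.Icc (-⌈4 / Δ⌉) ⌈4 / Δ⌉ := by
    intro i
    have h1 := abs_le.1 ((Plane.abs_apply_le_norm y i).trans hy)
    have h2 : y i / (Δ / 4) = y i * (4 / Δ) := by field_simp
    have h3 : 0 < 4 / Δ := by positivity
    rw [h2, Finset.mem_Icc]
    constructor
    · rw [Int.le_floor]
      push_cast
      nlinarith [Int.le_ceil (4 / Δ), h1.1]
    · have : (⌊y i * (4 / Δ)⌋ : ℝ) ≤ ⌈4 / Δ⌉ := by
        nlinarith [Int.le_ceil (4 / Δ), h1.2, Int.floor_le (y i * (4 / Δ))]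
      exact_mod_cast this
  rw [Finset.mem_product]
  exact ⟨key 0, key 1⟩

theorem card_Icc_ceil_le {Δ : ℝ} (hΔ : 0 < Δ) (hΔ1 : Δ ≤ 1) :
    ((Finset.Icc (-⌈4 / Δ⌉) ⌈4 / Δ⌉ ×ˢ Finset.Icc (-⌈4 / Δ⌉) ⌈4 / Δ⌉).card : ℝ) ≤
      121 / Δ ^ 2 := by
  have h0 : 0 < 4 / Δ := by positivity
  have hc : (0 : ℤ) ≤ ⌈4 / Δ⌉ := (Int.ceil_pos.2 h0).le
  have h1 : ((Finset.Icc (-⌈4 / Δ⌉) ⌈4 / Δ⌉).card : ℝ) = 2 * ⌈4 / Δ⌉ + 1 := by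
    rw [Int.card_Icc]
    have : (((⌈4 / Δ⌉ + 1 - -⌈4 / Δ⌉).toNat : ℤ) : ℝ) = 2 * ⌈4 / Δ⌉ + 1 := by
      rw [Int.toNat_of_nonneg (by omega)]
      push_cast
      ring
    exact_mod_cast this
  have h2 : (2 * ⌈4 / Δ⌉ + 1 : ℝ) ≤ 11 / Δ := by
    have h3 := Int.ceil_lt_add_one (4 / Δ)
    have h4 : 1 ≤ 1 / Δ := (one_le_div hΔ).2 hΔ1
    have h5 : 4 / Δ = 4 * (1 / Δ) := by ring
    have h6 : 11 / Δ = 11 * (1 / Δ) := by ring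
    linarith
  have h3 : (0 : ℝ) ≤ 2 * ⌈4 / Δ⌉ + 1 := by
    have : (0 : ℝ) ≤ ⌈4 / Δ⌉ := by exact_mod_cast hc
    linarith
  rw [Finset.card_product, Nat.cast_mul, h1]
  calc _ ≤ 11 / Δ * (11 / Δ) := by gcongr
    _ = _ := by ring

open MeasureTheory Metric in
/-- A part of `K` which at scale `Δ` is modelled by a finite set of points of nearly equal
weight. -/
structure MassClass (μ : Measure Plane) (K : Set Plane) (Δ η : ℝ) where
  carrier : Set Plane
  points : Finset Plane
  weight : ℝ
  weight_pos : 0 < weight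
  carrier_subset : carrier ⊆ K
  points_subset : (points : Set Plane) ⊆ K
  ncard_le_one : ∀ x, ((points : Set Plane) ∩ closedBall x Δ).ncard ≤ 1
  measure_le : ∀ S, μ (carrier ∩ S) ≤ ENNReal.ofReal
    (weight * ((points : Set Plane) ∩ {p | ∃ y ∈ S, dist p y ≤ Δ / 2}).ncard)
  le_measure : ∀ F ⊆ points, ∀ W, (∀ p ∈ F, closedBall p Δ ⊆ W) →
    ENNReal.ofReal (weight * Δ ^ η * F.card) ≤ μ W

open MeasureTheory Metric Set in
-- The class collects the squares of colour `c` with mass in `(Δ ^ (j * η + η), Δ ^ (j * η)]`. It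
-- keeps one representative per square, with weight `Δ ^ (j * η)`; the width of the interval is the
-- loss `Δ ^ η` in `le_measure`.
theorem exists_massClass {μ : Measure Plane} [IsProbabilityMeasure μ] {K : Set Plane}
    (hK : IsCompact K) (hKB : K ⊆ closedBall 0 1) {Δ η : ℝ} (hΔ : 0 < Δ)
    (j : ℕ) (c : ZMod 10 × ZMod 10) :
    ∃ M : MassClass μ K Δ η, ∀ y ∈ K,
      Δ ^ (j * η + η) < μ.real (K ∩ squareIndex (Δ / 4) ⁻¹' {squareIndex (Δ / 4) y}) →
      μ.real (K ∩ squareIndex (Δ / 4) ⁻¹' {squareIndex (Δ / 4) y}) ≤ Δ ^ (j * η) →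
      (((squareIndex (Δ / 4) y).1 : ZMod 10), ((squareIndex (Δ / 4) y).2 : ZMod 10)) = c →
      y ∈ M.carrier := by
  classical
  set q := squareIndex (Δ / 4) with hq
  have ha : 0 < Δ / 4 := by positivity
  set A : Set Plane := {y | y ∈ K ∧ Δ ^ (j * η + η) < μ.real (K ∩ q ⁻¹' {q y}) ∧
    μ.real (K ∩ q ⁻¹' {q y}) ≤ Δ ^ (j * η) ∧ (((q y).1 : ZMod 10), ((q y).2 : ZMod 10)) = c}
    with hA
  have hAK : A ⊆ K := fun y hy => hy.1
  have hT : (q '' A).Finite := by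
    refine (Finset.finite_toSet (Finset.Icc (-⌈4 / Δ⌉) ⌈4 / Δ⌉ ×ˢ
      Finset.Icc (-⌈4 / Δ⌉) ⌈4 / Δ⌉)).subset ?_
    rintro _ ⟨y, hy, rfl⟩
    exact squareIndex_mem hΔ (by simpa using hKB (hAK hy))
  have hrep : ∀ m ∈ q '' A, ∃ p ∈ A, q p = m := fun m hm => hm
  choose! rep hrepA hrepq using hrep
  set P : Finset Plane := hT.toFinset.image rep with hP
  have hPA : ∀ p ∈ P, p ∈ A := by
    intro p hp
    obtain ⟨m, hm, rfl⟩ := Finset.mem_image.1 hp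
    exact hrepA m (by simpa using hm)
  have hinj : ∀ p ∈ P, ∀ p' ∈ P, q p = q p' → p = p' := by
    intro p hp p' hp' h
    obtain ⟨m, hm, rfl⟩ := Finset.mem_image.1 hp
    obtain ⟨m', hm', rfl⟩ := Finset.mem_image.1 hp'
    rw [hrepq m (by simpa using hm), hrepq m' (by simpa using hm')] at h
    rw [h]
  have hmeas : ∀ m, MeasurableSet (K ∩ q ⁻¹' {m}) := fun m =>
    hK.isClosed.measurableSet.inter (measurable_squareIndex _ (measurableSet_singleton m))
  refine ⟨⟨A, P, Δ ^ (j * η), Real.rpow_pos_of_pos hΔ _, hAK, fun p hp => hAK (hPA p hp),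
    fun x => ?_, fun S => ?_, fun F hF W hW => ?_⟩, fun y hy h1 h2 h3 => ⟨hy, h1, h2, h3⟩⟩
  · refine (Set.ncard_le_one (P.finite_toSet.inter_of_left _)).2 ?_
    rintro p ⟨hp, hpx⟩ p' ⟨hp', hpx'⟩
    by_contra hne
    have hc : ((((q p).1 : ZMod 10), ((q p).2 : ZMod 10)) : ZMod 10 × ZMod 10) =
        (((q p').1 : ZMod 10), ((q p').2 : ZMod 10)) :=
      (hPA p hp).2.2.2.trans (hPA p' hp').2.2.2.symm
    rw [Prod.mk.injEq] at hc
    have := lt_dist_of_squareIndex ha hc.1 hc.2 fun h => hne (hinj p hp p' hp' h)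
    linarith [dist_triangle_right p p' x, mem_closedBall.1 hpx, mem_closedBall.1 hpx']
  · set T' := hT.toFinset.filter fun m => (A ∩ S ∩ q ⁻¹' {m}).Nonempty with hT'
    have hsub : A ∩ S ⊆ ⋃ m ∈ T', K ∩ q ⁻¹' {m} := by
      intro y hy
      refine mem_biUnion (x := q y) ?_ ⟨hAK hy.1, rfl⟩
      rw [hT', Finset.coe_filter]
      exact ⟨by simpa using ⟨y, hy.1, rfl⟩, y, hy, rfl⟩
    have hcard : T'.card ≤ ((P : Set Plane) ∩ {p | ∃ y ∈ S, dist p y ≤ Δ / 2}).ncard := by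
      rw [← Set.ncard_coe_finset]
      refine Set.ncard_le_ncard_of_injOn rep ?_ ?_ (P.finite_toSet.inter_of_left _)
      · intro m hm
        obtain ⟨hm1, y, hy, hym⟩ := Finset.mem_filter.1 (Finset.mem_coe.1 hm)
        refine ⟨Finset.mem_coe.2 (Finset.mem_image_of_mem rep hm1), y, hy.2, ?_⟩
        have := dist_le_of_squareIndex_eq ha (y := rep m) (z := y)
          ((hrepq m (by simpa using hm1)).trans hym.symm)
        linarith
      · intro m hm m' hm' h
        have hm1 := (Finset.mem_filter.1 (Finset.mem_coe.1 hm)).1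
        have hm1' := (Finset.mem_filter.1 (Finset.mem_coe.1 hm')).1
        rw [← hrepq m (by simpa using hm1), ← hrepq m' (by simpa using hm1'), h]
    calc μ (A ∩ S) ≤ ∑ m ∈ T', μ (K ∩ q ⁻¹' {m}) :=
          (measure_mono hsub).trans (measure_biUnion_finset_le _ _)
      _ ≤ ∑ _m ∈ T', ENNReal.ofReal (Δ ^ (j * η)) := by
          refine Finset.sum_le_sum fun m hm => ?_
          obtain ⟨-, y, hy, hym⟩ := Finset.mem_filter.1 hm
          have h1 := hy.1.2.2.1
          rw [show q y = m from hym] at h1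
          rw [← ofReal_measureReal]
          exact ENNReal.ofReal_le_ofReal h1
      _ = ENNReal.ofReal (Δ ^ (j * η) * T'.card) := sum_const_ofReal _ (Real.rpow_nonneg hΔ.le _)
      _ ≤ _ := by
          refine ENNReal.ofReal_le_ofReal ?_
          have : (T'.card : ℝ) ≤
              ((P : Set Plane) ∩ {p | ∃ y ∈ S, dist p y ≤ Δ / 2}).ncard := by exact_mod_cast hcard
          have h0 : 0 < Δ ^ (j * η) := Real.rpow_pos_of_pos hΔ _
          gcongr
  · have hdisj : (F : Set Plane).PairwiseDisjoint fun p => K ∩ q ⁻¹' {q p} := by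
      intro p hp p' hp' hne
      refine Set.disjoint_left.2 fun z hz hz' => hne (hinj p (hF hp) p' (hF hp') ?_)
      exact (hz.2 : q z = q p).symm.trans hz'.2
    have hΔη : Δ ^ (j * η) * Δ ^ η = Δ ^ (j * η + η) := (Real.rpow_add hΔ _ _).symm
    calc ENNReal.ofReal (Δ ^ (j * η) * Δ ^ η * F.card)
        = ∑ _p ∈ F, ENNReal.ofReal (Δ ^ (j * η + η)) := by
          rw [sum_const_ofReal _ (Real.rpow_nonneg hΔ.le _), hΔη]
      _ ≤ ∑ p ∈ F, μ (K ∩ q ⁻¹' {q p}) := by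
          refine Finset.sum_le_sum fun p hp => ?_
          rw [← ofReal_measureReal]
          exact ENNReal.ofReal_le_ofReal (hPA p (hF hp)).2.1.le
      _ = μ (⋃ p ∈ F, K ∩ q ⁻¹' {q p}) := (measure_biUnion_finset hdisj fun p _ => hmeas _).symm
      _ ≤ μ W := by
          refine measure_mono (iUnion₂_subset fun p hp z hz => hW p hp ?_)
          have := dist_le_of_squareIndex_eq ha (y := z) (z := p) hz.2
          rw [mem_closedBall]
          linarith

open MeasureTheory Metric Set in
/-- Up to a small part, `K` is covered by boundedly many mass classes. -/
theorem exists_massClass_cover {μ : Measure Plane} [IsProbabilityMeasure μ] {K : Set Plane}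
    (hK : IsCompact K) (hKB : K ⊆ closedBall 0 1) {Δ η : ℝ} (hΔ : 0 < Δ) (hΔ1 : Δ ≤ 1)
    {J : ℕ} (hJ : 3 ≤ J * η) :
    ∃ (M : Fin J × (ZMod 10 × ZMod 10) → MassClass μ K Δ η) (B : Set Plane),
      K ⊆ B ∪ ⋃ κ, (M κ).carrier ∧ μ B ≤ ENNReal.ofReal (121 * Δ) := by
  classical
  choose M hM using fun κ : Fin J × (ZMod 10 × ZMod 10) =>
    exists_massClass (μ := μ) (η := η) hK hKB hΔ (κ.1 : ℕ) κ.2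
  set q := squareIndex (Δ / 4) with hq
  refine ⟨M, {y | y ∈ K ∧ μ.real (K ∩ q ⁻¹' {q y}) ≤ Δ ^ (J * η)}, fun y hy => ?_, ?_⟩
  · by_cases hy' : μ.real (K ∩ q ⁻¹' {q y}) ≤ Δ ^ (J * η)
    · exact Or.inl ⟨hy, hy'⟩
    · right
      have hex : ∃ j : ℕ, Δ ^ (j * η) < μ.real (K ∩ q ⁻¹' {q y}) := ⟨J, not_le.1 hy'⟩
      have h0 : Nat.find hex ≠ 0 := by
        intro h0
        have h1 := Nat.find_spec hex
        rw [h0] at h1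
        simp only [Nat.cast_zero, zero_mul, Real.rpow_zero] at h1
        exact absurd measureReal_le_one (not_le.2 h1)
      obtain ⟨j, hj⟩ := Nat.exists_eq_succ_of_ne_zero h0
      have h1 := Nat.find_spec hex
      rw [hj, Nat.succ_eq_add_one, Nat.cast_add_one, add_mul, one_mul] at h1
      have h2 := not_lt.1 (Nat.find_min hex (m := j) (by omega))
      have h3 : j < J := by
        have := Nat.find_min' hex (not_le.1 hy')
        omega
      exact mem_iUnion.2 ⟨(⟨j, h3⟩, _), hM (⟨j, h3⟩, _) y hy h1 h2 rfl⟩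
  · set T := Finset.Icc (-⌈4 / Δ⌉) ⌈4 / Δ⌉ ×ˢ Finset.Icc (-⌈4 / Δ⌉) ⌈4 / Δ⌉ with hT
    set T' := T.filter fun m => μ.real (K ∩ q ⁻¹' {m}) ≤ Δ ^ (J * η) with hT'
    have hsub : {y | y ∈ K ∧ μ.real (K ∩ q ⁻¹' {q y}) ≤ Δ ^ (J * η)} ⊆
        ⋃ m ∈ T', K ∩ q ⁻¹' {m} := by
      rintro y ⟨hy, hy'⟩
      refine mem_biUnion (x := q y) ?_ ⟨hy, rfl⟩
      rw [hT', Finset.coe_filter]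
      exact ⟨squareIndex_mem hΔ (by simpa using hKB hy), hy'⟩
    -- There are at most `121 / Δ ^ 2` squares, so mass `Δ ^ 3` for each leaves `121 * Δ`, which is
    -- summable over dyadic scales.
    have hJ' : Δ ^ (J * η) ≤ Δ ^ 3 := by
      have := Real.rpow_le_rpow_of_exponent_ge hΔ hΔ1 hJ
      simpa using this
    calc μ {y | y ∈ K ∧ μ.real (K ∩ q ⁻¹' {q y}) ≤ Δ ^ (J * η)}
        ≤ ∑ m ∈ T', μ (K ∩ q ⁻¹' {m}) :=
          (measure_mono hsub).trans (measure_biUnion_finset_le _ _)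
      _ ≤ ∑ _m ∈ T', ENNReal.ofReal (Δ ^ 3) := by
          refine Finset.sum_le_sum fun m hm => ?_
          rw [← ofReal_measureReal]
          exact ENNReal.ofReal_le_ofReal ((Finset.mem_filter.1 hm).2.trans hJ')
      _ = ENNReal.ofReal (Δ ^ 3 * T'.card) := sum_const_ofReal _ (by positivity)
      _ ≤ _ := by
          refine ENNReal.ofReal_le_ofReal ?_
          have h1 : (T'.card : ℝ) ≤ T.card := by
            exact_mod_cast Finset.card_le_card (Finset.filter_subset _ _)
          have h2 := h1.trans (card_Icc_ceil_le hΔ hΔ1)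
          calc Δ ^ 3 * (T'.card : ℝ) ≤ Δ ^ 3 * (121 / Δ ^ 2) := by gcongr
            _ = 121 * Δ := by field_simp

/-! ### Concentration at infinitely many scales, and the resulting sets of lines. -/

section GoodPart

variable {X Y : Type*} [MeasurableSpace X] [MetricSpace Y]

open MeasureTheory Metric Set in
/-- The points of `A` around whose images `μ` has dimension at most `d + η` at scale `Δ`, and
dimension at least `d` at all small scales. -/
def concentratedPart (μ : Measure X) (K : Set X) (f : X → Y) (d η c : ℝ) (n : ℕ) (A : Set X)
    (Δ : ℝ) : Set X :=
  {y | y ∈ regularPart μ K f d n ∧ y ∈ A ∧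
    ENNReal.ofReal ((c * Δ / 4) ^ (d + η)) ≤ μ (K ∩ f ⁻¹' closedBall (f y) (c * Δ / 2))}

open MeasureTheory Metric Set in
/-- The concentrated points `y` of `A` for which `A` itself has large mass in the ball
around `f y`. -/
def goodPart (μ : Measure X) (K : Set X) (f : X → Y) (d η c : ℝ) (n : ℕ) (A : Set X)
    (Δ : ℝ) : Set X :=
  {y | y ∈ concentratedPart μ K f d η c n A Δ ∧
    ENNReal.ofReal (Δ ^ (d + 3 * η)) ≤ μ (A ∩ f ⁻¹' closedBall (f y) (c * Δ))}

open MeasureTheory Metric Set in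
-- Concentration allows at most `(c * Δ / 4) ^ (-(d + η))` balls in a cover of the image, and around
-- a bad point `A` has mass below `Δ ^ (d + 3 * η)`. The product leaves the gain `Δ ^ (2 * η)`.
theorem measure_concentratedPart_diff_goodPart_le [TopologicalSpace X] [BorelSpace X]
    {μ : Measure X} [IsProbabilityMeasure μ] {K : Set X} {f : X → Y} {d η c : ℝ} {n : ℕ}
    {A : Set X} {Δ : ℝ} (hK : IsClosed K) (hf : ContinuousOn f K) (hc : 0 < c) (hΔ : 0 < Δ) :
    μ (concentratedPart μ K f d η c n A Δ \ goodPart μ K f d η c n A Δ) ≤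
      ENNReal.ofReal ((c / 4) ^ (-(d + η)) * Δ ^ (2 * η)) := by
  set D := concentratedPart μ K f d η c n A Δ \ goodPart μ K f d η c n A Δ with hD
  have ha : 0 < (c * Δ / 4) ^ (d + η) := by positivity
  have hpack := packingNumber_le_of_measure_le (μ := μ) (V := f '' D) (W := univ) (w := 1) hK hf
    (show 0 < c * Δ by positivity) ha zero_le_one
    (by rintro _ ⟨y, hy, rfl⟩; exact hy.1.2.2) (fun _ _ => subset_univ _) (by simp)
  have hle : (coveringNumber (c * Δ).toNNReal (f '' D) : ℝ≥0∞) ≤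
      ENNReal.ofReal (1 / (c * Δ / 4) ^ (d + η)) :=
    (ENat.toENNReal_le.2 (coveringNumber_le_packingNumber _ _)).trans hpack
  have hfin : coveringNumber (c * Δ).toNNReal (f '' D) ≠ ⊤ := by
    intro h
    rw [h, ENat.toENNReal_top] at hle
    exact ENNReal.ofReal_ne_top (top_le_iff.1 hle)
  have h1 := measure_le_coveringNumber_mul (μ := μ) (D := D) (f := f)
    (b := ENNReal.ofReal (Δ ^ (d + 3 * η))) (show 0 ≤ c * Δ by positivity) hfin (by
      intro y hy
      have h2 : μ (A ∩ f ⁻¹' closedBall (f y) (c * Δ)) < ENNReal.ofReal (Δ ^ (d + 3 * η)) := by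
        by_contra h
        exact hy.2 ⟨hy.1, not_lt.1 h⟩
      refine le_trans (measure_mono ?_) h2.le
      exact inter_subset_inter_left _ fun z hz => hz.1.2.1)
  refine h1.trans ((mul_le_mul_left hle _).trans ?_)
  rw [← ENNReal.ofReal_mul (by positivity)]
  refine ENNReal.ofReal_le_ofReal (le_of_eq ?_)
  rw [show c * Δ / 4 = c / 4 * Δ by ring, Real.mul_rpow (by positivity) hΔ.le, one_div, mul_inv,
    ← Real.rpow_neg (by positivity), ← Real.rpow_neg hΔ.le, mul_assoc, ← Real.rpow_add hΔ]
  congr 2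
  ring

theorem tsum_ofReal_const_mul_pow_rpow_ne_top (C : ℝ) {a : ℝ} (ha : 0 < a) :
    ∑' k : ℕ, ENNReal.ofReal (C * ((1 / 2 : ℝ) ^ k) ^ a) ≠ ∞ := by
  have h1 : ∀ k : ℕ, ((1 / 2 : ℝ) ^ k) ^ a = ((1 / 2 : ℝ) ^ a) ^ k := fun k => by
    rw [← Real.rpow_natCast, ← Real.rpow_natCast, ← Real.rpow_mul (by norm_num),
      ← Real.rpow_mul (by norm_num), mul_comm]
  simp_rw [h1]
  refine Summable.tsum_ofReal_ne_top ((summable_geometric_of_lt_one (by positivity) ?_).mul_left C)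
  exact Real.rpow_lt_one (by norm_num) (by norm_num) ha

open MeasureTheory Metric Set in
/-- A point which is not regular of exponent `d + η` is concentrated at infinitely many dyadic
scales. -/
theorem exists_dyadic_of_notMem_regularPart {μ : Measure X} {K : Set X} {f : X → Y} {d η c : ℝ}
    (hdη : 0 ≤ d + η) (hc : 0 < c) {y : X} (hyK : y ∈ K)
    (hy : ∀ m, y ∉ regularPart μ K f (d + η) m) (k₀ : ℕ) :
    ∃ k ≥ k₀, ENNReal.ofReal ((c * (1 / 2 : ℝ) ^ k / 4) ^ (d + η)) ≤
      μ (K ∩ f ⁻¹' closedBall (f y) (c * (1 / 2 : ℝ) ^ k / 2)) := by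
  obtain ⟨m, hm⟩ := exists_nat_one_div_lt (show (0 : ℝ) < c * (1 / 2) ^ k₀ / 2 by positivity)
  have h1 : ¬ ∀ r, 0 < r → r ≤ 1 / ((m : ℝ) + 1) →
      μ (K ∩ f ⁻¹' closedBall (f y) r) ≤ ENNReal.ofReal (r ^ (d + η)) := fun h => hy m ⟨hyK, h⟩
  push Not at h1
  obtain ⟨r, hr, hrm, hlt⟩ := h1
  have hx0 : 0 < 2 * r / c := by positivity
  have hxk : 2 * r / c < (1 / 2) ^ k₀ := by
    rw [div_lt_iff₀ hc]
    linarith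
  have hx1 : 2 * r / c ≤ 1 := hxk.le.trans (pow_le_one₀ (by norm_num) (by norm_num))
  -- Rounding `2 * r / c` up to a power of `1 / 2` puts `r` between `c * Δ / 4` and `c * Δ / 2`, the
  -- two quantities in `concentratedPart`.
  obtain ⟨k, hk1, hk2⟩ := exists_nat_pow_near_of_lt_one hx0 hx1
    (show (0 : ℝ) < 1 / 2 by norm_num) (by norm_num)
  refine ⟨k, ?_, ?_⟩
  · have := (pow_lt_pow_iff_right_of_lt_one₀ (show (0 : ℝ) < 1 / 2 by norm_num) (by norm_num)).1
      (hk1.trans hxk)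
    omega
  · rw [lt_div_iff₀ hc, pow_succ] at hk1
    rw [div_le_iff₀ hc] at hk2
    calc ENNReal.ofReal ((c * (1 / 2 : ℝ) ^ k / 4) ^ (d + η))
        ≤ ENNReal.ofReal (r ^ (d + η)) := by
          refine ENNReal.ofReal_le_ofReal (Real.rpow_le_rpow (by positivity) ?_ hdη)
          linarith
      _ ≤ μ (K ∩ f ⁻¹' closedBall (f y) r) := hlt.le
      _ ≤ _ := by
          refine measure_mono (inter_subset_inter_right _ (preimage_mono ?_))
          exact closedBall_subset_closedBall (by linarith)

open MeasureTheory Metric Set in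
/-- At infinitely many dyadic scales, a good part has large mass. -/
theorem exists_le_measure_goodPart [TopologicalSpace X] [BorelSpace X]
    {μ : Measure X} [IsProbabilityMeasure μ] {K : Set X} {f : X → Y} {d η c : ℝ} {n : ℕ}
    {ι : Type*} [Fintype ι] {A : ℕ → ι → Set X} {B : ℕ → Set X} {CB : ℝ}
    (hK : IsClosed K) (hf : ContinuousOn f K) (hd : 0 ≤ d) (hη : 0 < η) (hc : 0 < c)
    (hpos : μ (regularPart μ K f d n) ≠ 0) (hzero : ∀ m, μ (regularPart μ K f (d + η) m) = 0)
    (hcov : ∀ k, K ⊆ B k ∪ ⋃ i, A k i)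
    (hB : ∀ k, μ (B k) ≤ ENNReal.ofReal (CB * (1 / 2 : ℝ) ^ k)) (k₀ : ℕ) :
    ∃ k ≥ k₀, ∃ i, ENNReal.ofReal (((1 / 2 : ℝ) ^ k) ^ (2 * η)) ≤
      μ (goodPart μ K f d η c n (A k i) ((1 / 2 : ℝ) ^ k)) := by
  classical
  set Δ : ℕ → ℝ := fun k => (1 / 2 : ℝ) ^ k with hΔ
  have hΔ0 : ∀ k, 0 < Δ k := fun k => by positivity
  set C : ℝ := (c / 4) ^ (-(d + η)) with hC
  have hC0 : 0 < C := by positivity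
  -- In `C + 1`, the `C` pays for concentrated points that are not good, and the `1` for good parts
  -- of mass below `Δ ^ (2 * η)`.
  set b : ℕ → ℝ≥0∞ := fun k => ENNReal.ofReal (CB * Δ k ^ (1 : ℝ)) +
    ENNReal.ofReal (Fintype.card ι * (C + 1) * Δ k ^ (2 * η)) with hb
  have hbsum : ∑' k, b k ≠ ∞ := by
    rw [ENNReal.tsum_add]
    exact ENNReal.add_ne_top.2 ⟨tsum_ofReal_const_mul_pow_rpow_ne_top _ one_pos,
      tsum_ofReal_const_mul_pow_rpow_ne_top _ (by positivity)⟩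
  obtain ⟨k, hk, hlt⟩ := exists_lt_measure_of_frequently (μ := μ)
    (A := regularPart μ K f d n) (N := ⋃ m, regularPart μ K f (d + η) m)
    (M := fun k => B k ∪ ⋃ i, concentratedPart μ K f d η c n (A k i) (Δ k)) (b := b) hpos
    (measure_iUnion_null hzero) (by
      intro y hy
      by_cases hyN : y ∈ ⋃ m, regularPart μ K f (d + η) m
      · exact Or.inl hyN
      refine Or.inr fun k₁ => ?_
      obtain ⟨k, hk, hyk⟩ := exists_dyadic_of_notMem_regularPart (μ := μ) (K := K) (f := f)
        (show 0 ≤ d + η by positivity) hc hy.1 (fun m hm => hyN (mem_iUnion.2 ⟨m, hm⟩)) k₁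
      refine ⟨k, hk, (hcov k hy.1).imp id fun hyA => ?_⟩
      obtain ⟨i, hi⟩ := mem_iUnion.1 hyA
      exact mem_iUnion.2 ⟨i, hy, hi, hyk⟩) hbsum k₀
  refine ⟨k, hk, ?_⟩
  by_contra! hcon
  refine absurd hlt (not_lt.2 ?_)
  have h1 : ∀ i, μ (concentratedPart μ K f d η c n (A k i) (Δ k)) ≤
      ENNReal.ofReal ((C + 1) * Δ k ^ (2 * η)) := by
    intro i
    have h2 : μ (concentratedPart μ K f d η c n (A k i) (Δ k)) ≤
        μ (concentratedPart μ K f d η c n (A k i) (Δ k) \ goodPart μ K f d η c n (A k i) (Δ k)) +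
        μ (goodPart μ K f d η c n (A k i) (Δ k)) := by
      refine (measure_mono ?_).trans (measure_union_le _ _)
      exact subset_sdiff_union _ _
    refine h2.trans ((add_le_add (measure_concentratedPart_diff_goodPart_le hK hf hc (hΔ0 k))
      (hcon i).le).trans ?_)
    have := Real.rpow_pos_of_pos (hΔ0 k) (2 * η)
    rw [← ENNReal.ofReal_add (by positivity) (by positivity), add_mul, one_mul]
  calc μ (B k ∪ ⋃ i, concentratedPart μ K f d η c n (A k i) (Δ k))
      ≤ μ (B k) + ∑ i, μ (concentratedPart μ K f d η c n (A k i) (Δ k)) := by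
        refine (measure_union_le _ _).trans (add_le_add le_rfl ?_)
        exact measure_iUnion_fintype_le _ _
    _ ≤ ENNReal.ofReal (CB * Δ k ^ (1 : ℝ)) + ∑ _i : ι, ENNReal.ofReal ((C + 1) * Δ k ^ (2 * η)) := by
        refine add_le_add ?_ (Finset.sum_le_sum fun i _ => h1 i)
        rw [Real.rpow_one]
        exact hB k
    _ = b k := by
        have := Real.rpow_pos_of_pos (hΔ0 k) (2 * η)
        rw [sum_const_ofReal _ (by positivity), hb, Finset.card_univ]
        congr 2
        ring

open MeasureTheory Metric Set in
/-- The image of a set of concentrated points of large mass is a `(Δ, d)`-set. -/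
theorem isDeltaSet_image [TopologicalSpace X] [BorelSpace X]
    {μ : Measure X} [IsProbabilityMeasure μ] {K : Set X} {f : X → Y} {d η c : ℝ} {n : ℕ}
    {A G : Set X} {Δ : ℝ} (hK : IsCompact K) (hKc : IsClosed K) (hf : ContinuousOn f K)
    (hd : 0 ≤ d) (hc : 0 < c) (hc1 : c ≤ 1)
    (hΔ : 0 < Δ) (hΔn : 2 * Δ ≤ 1 / ((n : ℝ) + 1))
    (hG : G ⊆ concentratedPart μ K f d η c n A Δ)
    (hGμ : ENNReal.ofReal (Δ ^ (2 * η)) ≤ μ G) :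
    IsDeltaSet Δ d ((3 * ((n : ℝ) + 1)) ^ d * 2 ^ d * (c / 4) ^ (-(d + η)) * Δ ^ (-(3 * η)))
      (f '' G) := by
  have hGK : G ⊆ K := fun y hy => (hG hy).1.1
  have hfin : ballCoveringNumber Δ (f '' G) ≠ ⊤ := by
    obtain ⟨C, -, hCfin, hC⟩ := exists_finite_isCover_of_isCompact (ε := Δ.toNNReal)
      (Real.toNNReal_pos.2 hΔ).ne' (hK.image_of_continuousOn hf)
    exact ne_top_of_le_ne_top hCfin.encard_lt_top.ne
      (hC.anti (image_mono hGK)).externalCoveringNumber_le_encard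
  refine ⟨hfin, fun z R hR => ?_⟩
  have hR0 : 0 < R := hΔ.trans_le hR
  -- Regularity bounds each `Δ`-ball by `(2 * Δ) ^ d`, so the mass of `G` forces many balls.
  -- Concentration will give the opposite bound for the part inside a ball of radius `R`.
  have hlow := hGμ.trans (measure_le_ballCoveringNumber_mul (μ := μ)
    (b := ENNReal.ofReal ((2 * Δ) ^ d)) hΔ.le hfin (by
      intro z
      rcases (G ∩ f ⁻¹' closedBall z Δ).eq_empty_or_nonempty with h0 | ⟨y, hyG, hyz⟩
      · simp [h0]
      refine (measure_mono ?_).trans ((hG hyG).1.2 (2 * Δ) (by positivity) hΔn)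
      refine fun p hp => ⟨hGK hp.1, ?_⟩
      rw [mem_preimage, mem_closedBall]
      linarith [dist_triangle_right (f p) (f y) z, mem_closedBall.1 hp.2, mem_closedBall.1 hyz]))
  obtain ⟨N, hN⟩ := ENat.ne_top_iff_exists.1 hfin
  rw [← hN] at hlow ⊢
  rw [ENat.toENNReal_coe, ← ENNReal.ofReal_natCast] at hlow ⊢
  rw [← ENNReal.ofReal_mul (by positivity), ENNReal.ofReal_le_ofReal_iff (by positivity)] at hlow
  rcases (f '' G ∩ closedBall z R).eq_empty_or_nonempty with h0 | ⟨_, ⟨y₀, hy₀, rfl⟩, hy₀z⟩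
  · rw [h0, ballCoveringNumber, externalCoveringNumber_empty]
    simp
  have ha : 0 < (c * Δ / 4) ^ (d + η) := by positivity
  -- The factor `n + 1` makes the bound at least `1` when `3 * R` is beyond the range of regularity.
  have hw : μ (K ∩ f ⁻¹' closedBall (f y₀) (3 * R)) ≤
      ENNReal.ofReal ((3 * ((n : ℝ) + 1) * R) ^ d) := by
    by_cases h3 : 3 * R ≤ 1 / ((n : ℝ) + 1)
    · refine ((hG hy₀).1.2 (3 * R) (by positivity) h3).trans (ENNReal.ofReal_le_ofReal ?_)
      refine Real.rpow_le_rpow (by positivity) ?_ hd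
      nlinarith [(Nat.cast_nonneg n : (0 : ℝ) ≤ n)]
    · refine prob_le_one.trans ?_
      rw [← ENNReal.ofReal_one]
      refine ENNReal.ofReal_le_ofReal (Real.one_le_rpow ?_ hd)
      rw [not_le, div_lt_iff₀ (by positivity)] at h3
      linarith
  have hpack := packingNumber_le_of_measure_le (μ := μ) (V := f '' G ∩ closedBall z R) hKc hf
    (show 0 < c * Δ by positivity) ha (by positivity)
    (by rintro _ ⟨⟨y, hy, rfl⟩, -⟩; exact (hG hy).2.2) (by
      rintro v ⟨-, hv⟩ p ⟨hpK, hp⟩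
      refine ⟨hpK, ?_⟩
      rw [mem_preimage, mem_closedBall] at *
      have h1 : c * Δ ≤ R := by nlinarith
      linarith [dist_triangle_right (f p) (f y₀) z, dist_triangle (f p) v z]) hw
  have hnum : ballCoveringNumber Δ (f '' G ∩ closedBall z R) ≤
      packingNumber (c * Δ).toNNReal (f '' G ∩ closedBall z R) :=
    (externalCoveringNumber_anti (Real.toNNReal_le_toNNReal (by nlinarith))).trans
      ((externalCoveringNumber_le_coveringNumber _ _).trans (coveringNumber_le_packingNumber _ _))
  refine (ENat.toENNReal_le.2 hnum).trans (hpack.trans ?_)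
  rw [← ENNReal.ofReal_mul (by positivity)]
  refine ENNReal.ofReal_le_ofReal ?_
  have e1 : (3 * ((n : ℝ) + 1) * R) ^ d = (3 * ((n : ℝ) + 1)) ^ d * R ^ d :=
    Real.mul_rpow (by positivity) hR0.le
  have e2 : ((c * Δ / 4) ^ (d + η))⁻¹ = (c / 4) ^ (-(d + η)) * Δ ^ (-(d + η)) := by
    rw [show c * Δ / 4 = c / 4 * Δ by ring, Real.mul_rpow (by positivity) hΔ.le, mul_inv,
      ← Real.rpow_neg (by positivity), ← Real.rpow_neg hΔ.le]
  have e3 : Δ ^ (-(d + η)) ≤ N * (2 ^ d * Δ ^ (-(3 * η))) := by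
    have h1 : Δ ^ (-(d + η)) = Δ ^ (2 * η) * Δ ^ (-(d + 3 * η)) := by
      rw [← Real.rpow_add hΔ]
      congr 1
      ring
    have h2 : Δ ^ (-(3 * η)) = Δ ^ d * Δ ^ (-(d + 3 * η)) := by
      rw [← Real.rpow_add hΔ]
      congr 1
      ring
    rw [Real.mul_rpow (by norm_num) hΔ.le] at hlow
    have h3 : 0 < Δ ^ (-(d + 3 * η)) := Real.rpow_pos_of_pos hΔ _
    rw [h1, h2]
    calc _ ≤ N * (2 ^ d * Δ ^ d) * Δ ^ (-(d + 3 * η)) := by gcongr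
      _ = _ := by ring
  have h4 : 0 ≤ (c / 4) ^ (-(d + η)) := by positivity
  rw [div_eq_mul_inv, e1, e2]
  calc _ ≤ (3 * ((n : ℝ) + 1)) ^ d * R ^ d *
        ((c / 4) ^ (-(d + η)) * (N * (2 ^ d * Δ ^ (-(3 * η))))) := by gcongr
    _ = _ := by ring

end GoodPart

/-! ### Finite sets as `(δ, s, C)`-sets. -/

section Sets

variable {X : Type*} [MetricSpace X]

open Metric Set in
theorem card_le_ballCoveringNumber {P : Finset X} {δ : ℝ} (hδ : 0 ≤ δ)
    (h : ∀ x, ((P : Set X) ∩ closedBall x δ).ncard ≤ 1) :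
    (P.card : ℕ∞) ≤ ballCoveringNumber δ (P : Set X) := by
  refine le_iInf₂ fun C hC => ?_
  rw [isCover_iff_subset_iUnion_closedBall, Real.coe_toNNReal δ hδ] at hC
  have hex : ∀ p ∈ (P : Set X), ∃ z ∈ C, p ∈ closedBall z δ := fun p hp => by
    simpa using hC hp
  choose! z hzC hz using hex
  rw [← Set.encard_coe_eq_coe_finsetCard]
  refine Set.encard_le_encard_of_injOn (f := z) hzC fun p hp q hq hpq => ?_
  exact (Set.ncard_le_one (P.finite_toSet.inter_of_left _)).1 (h (z p)) p ⟨hp, hz p hp⟩ q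
    ⟨hq, hpq ▸ hz q hq⟩

open Metric Set in
theorem isSeparated_of_ncard_le_one {P : Finset X} {δ : ℝ} (hδ : 0 ≤ δ)
    (h : ∀ x, ((P : Set X) ∩ closedBall x δ).ncard ≤ 1) :
    IsSeparated (ENNReal.ofReal δ) (P : Set X) := by
  intro p hp q hq hpq
  rw [edist_dist, ENNReal.ofReal_lt_ofReal_iff_of_nonneg hδ]
  by_contra hle
  refine hpq ((Set.ncard_le_one (P.finite_toSet.inter_of_left _)).1 (h q) p
    ⟨hp, not_lt.1 hle⟩ q ⟨hq, mem_closedBall_self hδ⟩)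

theorem IsDeltaSet.mono_const {δ s C C' : ℝ} {P : Set X} (hδ : 0 < δ) (h : IsDeltaSet δ s C P)
    (hC : C ≤ C') : IsDeltaSet δ s C' P := by
  refine ⟨h.1, fun x r hr => (h.2 x r hr).trans ?_⟩
  have : 0 ≤ r ^ s := Real.rpow_nonneg (hδ.le.trans hr) s
  gcongr

open Metric Set in
/-- A finite set with at most one point in each `δ`-ball is a `(δ, s, C)`-set, if cardinalities
satisfy the required inequality with an exponent `s' ≥ s` for small radii. -/
theorem isDeltaSet_of_ncard_le {P : Finset X} {δ s s' C ρ : ℝ} (hδ : 0 < δ) (hs : 0 ≤ s)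
    (hss' : s ≤ s') (hρ : 0 < ρ) (hρ1 : ρ ≤ 1) (hC : 0 ≤ C)
    (h1 : ∀ x, ((P : Set X) ∩ closedBall x δ).ncard ≤ 1)
    (h : ∀ x r, δ ≤ r → r ≤ ρ →
      (((P : Set X) ∩ closedBall x r).ncard : ℝ) ≤ C * r ^ s' * P.card) :
    IsDeltaSet δ s (C + (ρ ^ s)⁻¹) (P : Set X) := by
  have hcov : ballCoveringNumber δ (P : Set X) = P.card :=
    le_antisymm ((externalCoveringNumber_le_encard_self _).trans_eq
      (Set.encard_coe_eq_coe_finsetCard P)) (card_le_ballCoveringNumber hδ.le h1)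
  refine ⟨by rw [hcov]; exact ENat.natCast_ne_top _, fun x r hr => ?_⟩
  have hr0 : 0 < r := hδ.trans_le hr
  have hrs : 0 < r ^ s := Real.rpow_pos_of_pos hr0 s
  have hρs : 0 < ρ ^ s := Real.rpow_pos_of_pos hρ s
  have hfin : ((P : Set X) ∩ closedBall x r).Finite := P.finite_toSet.inter_of_left _
  have hle : ballCoveringNumber δ ((P : Set X) ∩ closedBall x r) ≤
      (((P : Set X) ∩ closedBall x r).ncard : ℕ∞) := by
    rw [hfin.cast_ncard_eq]
    exact externalCoveringNumber_le_encard_self _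
  refine (ENat.toENNReal_le.2 hle).trans ?_
  rw [hcov, ENat.toENNReal_coe, ENat.toENNReal_coe, ← ENNReal.ofReal_natCast,
    ← ENNReal.ofReal_natCast, ← ENNReal.ofReal_mul (by positivity)]
  refine ENNReal.ofReal_le_ofReal ?_
  by_cases hrρ : r ≤ ρ
  · refine (h x r hr hrρ).trans ?_
    have h2 : r ^ s' ≤ r ^ s :=
      Real.rpow_le_rpow_of_exponent_ge hr0 (hrρ.trans hρ1) hss'
    have h3 : 0 ≤ (ρ ^ s)⁻¹ := by positivity
    gcongr
    linarith
  · have h2 : (((P : Set X) ∩ closedBall x r).ncard : ℝ) ≤ P.card := by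
      rw [← Set.ncard_coe_finset]
      exact_mod_cast Set.ncard_le_ncard inter_subset_left P.finite_toSet
    have h3 : ρ ^ s ≤ r ^ s := Real.rpow_le_rpow hρ.le (not_le.1 hrρ).le hs
    have h4 : 1 ≤ (ρ ^ s)⁻¹ * r ^ s := by
      rw [inv_mul_eq_div]
      exact (one_le_div hρs).2 h3
    have h5 : 1 ≤ (C + (ρ ^ s)⁻¹) * r ^ s := by nlinarith [mul_nonneg hC hrs.le]
    calc _ ≤ 1 * (P.card : ℝ) := by rw [one_mul]; exact h2
      _ ≤ _ := by gcongr

end Sets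

/-! ### Absorbing constants at small dyadic scales. -/

theorem exists_forall_mul_rpow_neg_le (C : ℝ) {a b : ℝ} (hab : a < b) :
    ∃ k₀ : ℕ, ∀ k ≥ k₀, C * ((1 / 2 : ℝ) ^ k) ^ (-a) ≤ ((1 / 2 : ℝ) ^ k) ^ (-b) := by
  have h1 : Filter.Tendsto (fun k : ℕ => C * ((1 / 2 : ℝ) ^ k) ^ (b - a)) Filter.atTop
      (nhds 0) := by
    have h2 := tendsto_pow_atTop_nhds_zero_of_lt_one (show (0 : ℝ) ≤ 1 / 2 by norm_num)
      (by norm_num)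
    have h3 := (Real.continuousAt_rpow_const 0 (b - a) (Or.inr (sub_pos.2 hab).le)).tendsto.comp h2
    rw [Real.zero_rpow (sub_pos.2 hab).ne'] at h3
    simpa using h3.const_mul C
  obtain ⟨k₀, hk₀⟩ := Filter.eventually_atTop.1 (h1.eventually_le_const one_pos)
  refine ⟨k₀, fun k hk => ?_⟩
  have hΔ : (0 : ℝ) < (1 / 2 : ℝ) ^ k := by positivity
  have h4 : ((1 / 2 : ℝ) ^ k) ^ (-a) = ((1 / 2 : ℝ) ^ k) ^ (b - a) * ((1 / 2 : ℝ) ^ k) ^ (-b) := by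
    rw [← Real.rpow_add hΔ]
    congr 1
    ring
  rw [h4, ← mul_assoc]
  exact mul_le_of_le_one_left (Real.rpow_nonneg hΔ.le _) (hk₀ k hk)

theorem exists_forall_pow_half_le {r : ℝ} (hr : 0 < r) :
    ∃ k₀ : ℕ, ∀ k ≥ k₀, (1 / 2 : ℝ) ^ k ≤ r :=
  Filter.eventually_atTop.1 ((tendsto_pow_atTop_nhds_zero_of_lt_one
    (show (0 : ℝ) ≤ 1 / 2 by norm_num) (by norm_num)).eventually_le_const hr)

theorem exists_lt_ofReal_lt {s : ℝ} (hs : 0 ≤ s) {D : ℝ≥0∞} (h : ENNReal.ofReal s < D) :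
    ∃ s' : ℝ, s < s' ∧ ENNReal.ofReal s' < D := by
  obtain ⟨r, h1, h2⟩ := ENNReal.lt_iff_exists_nnreal_btwn.1 h
  refine ⟨r, ?_, by simpa using h2⟩
  rw [← ENNReal.ofReal_coe_nnreal] at h1
  exact (ENNReal.ofReal_lt_ofReal_iff_of_nonneg hs).1 h1

open MeasureTheory Metric Set in
-- Counting points is measuring: the Frostman bound on the ball of radius `2 * r` limits the points
-- in a ball with loss `Δ ^ (-η)`, and the mass of the carrier bounds the total number below with
-- loss `Δ ^ (-(2 * η))`.
theorem MassClass.isDeltaSet {μ : Measure Plane} {K : Set Plane} {Δ η t t' C : ℝ}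
    (M : MassClass μ K Δ η) (hΔ : 0 < Δ) (hΔ1 : Δ ≤ 1) (hη : 0 ≤ η) (ht : 0 ≤ t) (htt' : t ≤ t')
    (hC : 0 ≤ C) (hμ : ∀ x r, 0 < r → μ (closedBall x r) ≤ ENNReal.ofReal (C * r ^ t'))
    (hM : ENNReal.ofReal (Δ ^ (2 * η)) ≤ μ M.carrier) :
    IsDeltaSet Δ t ((C * 2 ^ t' + 1) * Δ ^ (-(3 * η))) (M.points : Set Plane) := by
  classical
  have hw := M.weight_pos
  have hM' : Δ ^ (2 * η) ≤ M.weight * M.points.card := by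
    have h1 := M.measure_le univ
    rw [inter_univ] at h1
    have h2 := (ENNReal.ofReal_le_ofReal_iff (by positivity)).1 (hM.trans h1)
    refine h2.trans (mul_le_mul_of_nonneg_left ?_ hw.le)
    rw [← Set.ncard_coe_finset]
    exact_mod_cast Set.ncard_le_ncard inter_subset_left M.points.finite_toSet
  have h1 : 1 ≤ Δ ^ (-(3 * η)) :=
    Real.one_le_rpow_of_pos_of_le_one_of_nonpos hΔ hΔ1 (by linarith)
  refine (isDeltaSet_of_ncard_le (C := C * 2 ^ t' * Δ ^ (-(3 * η))) (ρ := 1) hΔ ht htt' one_pos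
    le_rfl (by positivity) M.ncard_le_one ?_).mono_const hΔ (by simp; linarith)
  intro x r hr _
  have hr0 : 0 < r := hΔ.trans_le hr
  have h2 := (M.le_measure (M.points.filter (· ∈ closedBall x r)) (Finset.filter_subset _ _)
    (closedBall x (2 * r)) (by
      intro p hp
      refine closedBall_subset_closedBall' ?_
      have := mem_closedBall.1 (Finset.mem_filter.1 hp).2
      linarith)).trans (hμ x (2 * r) (by positivity))
  have h3 : (M.points.filter (· ∈ closedBall x r)).card =
      ((M.points : Set Plane) ∩ closedBall x r).ncard := by
    rw [← Set.ncard_coe_finset]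
    congr 1
    ext z
    simp
  rw [h3, ENNReal.ofReal_le_ofReal_iff (by positivity), Real.mul_rpow (by norm_num) hr0.le] at h2
  set m : ℝ := (((M.points : Set Plane) ∩ closedBall x r).ncard : ℝ) with hm
  have h4 : Δ ^ (-(3 * η)) = Δ ^ (-η) * Δ ^ (-(2 * η)) := by
    rw [← Real.rpow_add hΔ]
    congr 1
    ring
  have h5 : Δ ^ η * Δ ^ (-η) = 1 := by rw [← Real.rpow_add hΔ, add_neg_cancel, Real.rpow_zero]
  have h6 : Δ ^ (2 * η) * Δ ^ (-(2 * η)) = 1 := by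
    rw [← Real.rpow_add hΔ, add_neg_cancel, Real.rpow_zero]
  have h7 : 0 < Δ ^ (-η) := Real.rpow_pos_of_pos hΔ _
  have h8 : 0 < Δ ^ (-(2 * η)) := Real.rpow_pos_of_pos hΔ _
  have h9 : M.weight * m ≤ C * (2 ^ t' * r ^ t') * Δ ^ (-η) := by
    calc M.weight * m = M.weight * Δ ^ η * m * Δ ^ (-η) := by linear_combination (-M.weight * m) * h5
      _ ≤ _ := by gcongr
  have h10 : 1 ≤ M.weight * M.points.card * Δ ^ (-(2 * η)) := by
    rw [← h6]
    gcongr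
  rw [h4]
  refine le_of_mul_le_mul_left ?_ hw
  calc M.weight * m ≤ C * (2 ^ t' * r ^ t') * Δ ^ (-η) * 1 := by rw [mul_one]; exact h9
    _ ≤ C * (2 ^ t' * r ^ t') * Δ ^ (-η) * (M.weight * M.points.card * Δ ^ (-(2 * η))) := by gcongr
    _ = _ := by ring

open MeasureTheory Metric Set in
-- A line through `x` within `c * Δ` of `join x y` stays within `Δ / 2` of it on the unit ball, and
-- passing to a representative costs another `Δ / 2`. So the mass at a good point becomes points in
-- the tube. As `μ` has total mass `1`, the weighted number of points is at most `Δ ^ (-η)`, which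
-- turns `3 * η` into `4 * η`.
theorem le_ncard_tube_inter {μ : Measure Plane} [IsProbabilityMeasure μ] {K : Set Plane}
    {Δ η d c : ℝ} {n : ℕ} (M : MassClass μ K Δ η) (hΔ : 0 < Δ) {x y : Plane}
    (hc : c * (‖x‖ + 1) ≤ 1 / 2) (hKB : K ⊆ closedBall 0 1)
    (hy : y ∈ goodPart μ K (PlaneLine.join x) d η c n M.carrier Δ) :
    Δ ^ (d + 4 * η) * ((M.points : Set Plane).ncard : ℝ) ≤
      ((PlaneLine.tube Δ (PlaneLine.join x y) ∩ M.points).ncard : ℝ) := by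
  have hw := M.weight_pos
  have h1 := hy.2.trans ((measure_mono (show M.carrier ∩ PlaneLine.join x ⁻¹'
      closedBall (PlaneLine.join x y) (c * Δ) ⊆ M.carrier ∩ (K ∩ PlaneLine.join x ⁻¹'
      closedBall (PlaneLine.join x y) (c * Δ)) from
    fun z hz => ⟨hz.1, M.carrier_subset hz.1, hz.2⟩)).trans (M.measure_le _))
  rw [ENNReal.ofReal_le_ofReal_iff (by positivity)] at h1
  have h2 : ((M.points : Set Plane) ∩ {p | ∃ z ∈ K ∩ PlaneLine.join x ⁻¹'
      closedBall (PlaneLine.join x y) (c * Δ), dist p z ≤ Δ / 2}).ncard ≤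
      (PlaneLine.tube Δ (PlaneLine.join x y) ∩ M.points).ncard := by
    refine Set.ncard_le_ncard ?_ (M.points.finite_toSet.inter_of_right _)
    rintro p ⟨hp, z, ⟨hzK, hz⟩, hpz⟩
    refine ⟨?_, hp⟩
    have hz1 : ‖z‖ ≤ 1 := by simpa using hKB hzK
    have h3 : infDist z ((PlaneLine.join x y).carrier : Set Plane) ≤ Δ / 2 := by
      refine (PlaneLine.infDist_le_of_mem (PlaneLine.mem_join_left x z)
        (PlaneLine.mem_join_left x y) (PlaneLine.mem_join_right x z)).trans ?_
      have h4 : ‖z - x‖ ≤ ‖x‖ + 1 := (norm_sub_le z x).trans (by linarith)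
      have h5 : dist (PlaneLine.join x z) (PlaneLine.join x y) ≤ c * Δ := hz
      calc _ ≤ c * Δ * (‖x‖ + 1) := by
            gcongr
            exact dist_nonneg.trans h5
        _ = c * (‖x‖ + 1) * Δ := by ring
        _ ≤ 1 / 2 * Δ := by gcongr
        _ = Δ / 2 := by ring
    have h6 : infDist p ((PlaneLine.join x y).carrier : Set Plane) ≤ Δ :=
      infDist_le_infDist_add_dist.trans (by linarith)
    rw [PlaneLine.tube, mem_cthickening_iff]
    rw [← ENNReal.ofReal_toReal (infEDist_ne_top (PlaneLine.join x y).nonempty)]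
    exact ENNReal.ofReal_le_ofReal h6
  have h3 := M.le_measure M.points subset_rfl univ fun _ _ => subset_univ _
  rw [measure_univ, ← ENNReal.ofReal_one, ENNReal.ofReal_le_ofReal_iff zero_le_one] at h3
  rw [Set.ncard_coe_finset]
  have h4 : Δ ^ (d + 4 * η) = Δ ^ (d + 3 * η) * Δ ^ η := by
    rw [← Real.rpow_add hΔ]
    congr 1
    ring
  refine le_of_mul_le_mul_left ?_ hw
  calc M.weight * (Δ ^ (d + 4 * η) * M.points.card)
      = Δ ^ (d + 3 * η) * (M.weight * Δ ^ η * M.points.card) := by rw [h4]; ring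
    _ ≤ Δ ^ (d + 3 * η) * 1 := by gcongr
    _ ≤ _ := by
        rw [mul_one]
        refine h1.trans ?_
        gcongr

open MeasureTheory Metric Set in
/-- A set charged by a Frostman-type outer measure contains a `(δ, s)`-set. -/
theorem exists_isDeltaSet_of_le_outerMeasure {X : Type*} [MetricSpace X] {O : OuterMeasure X}
    {s s' ρ δ η : ℝ} {A : Set X} (hO : ∀ S, ediam S ≤ ENNReal.ofReal ρ → O S ≤ ediam S ^ s')
    (hA : TotallyBounded A) (hs : 0 ≤ s) (hss' : s ≤ s') (hδ : 0 < δ) (hδ1 : δ ≤ 1)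
    (hδρ : δ ≤ ρ / 10) (hη : 0 ≤ η) (hOA : ENNReal.ofReal (δ ^ η) ≤ O A) :
    ∃ P : Finset X, ↑P ⊆ A ∧ P.Nonempty ∧ IsSeparated (ENNReal.ofReal δ) (P : Set X) ∧
      IsDeltaSet δ s ((2 * 10 ^ s' + ((min (ρ / 10) 1) ^ s)⁻¹) * δ ^ (-η)) (P : Set X) := by
  have hs' : 0 ≤ s' := hs.trans hss'
  obtain ⟨P, hPA, hP, hcard⟩ := exists_finset_frostman hO hA hs' hδ hδρ
  have hδη : 0 < δ ^ η := Real.rpow_pos_of_pos hδ η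
  have hδs : 0 < δ ^ s' := Real.rpow_pos_of_pos hδ s'
  have hle := hOA.trans hcard
  rw [ENNReal.ofReal_le_ofReal_iff (by positivity)] at hle
  have hne : P.Nonempty := by
    rw [Finset.nonempty_iff_ne_empty]
    rintro rfl
    simp only [Finset.card_empty, Nat.cast_zero, mul_zero] at hle
    linarith
  have h1 : ∀ x, ((P : Set X) ∩ closedBall x δ).ncard ≤ 1 := by
    intro x
    have := hP x δ le_rfl hδρ
    rw [div_self hδ.ne', Real.one_rpow] at this
    exact_mod_cast this
  refine ⟨P, hPA, hne, isSeparated_of_ncard_le_one hδ.le h1, ?_⟩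
  have hρ0 : 0 < ρ / 10 := hδ.trans_le hδρ
  have hone : 1 ≤ δ ^ (-η) := Real.one_le_rpow_of_pos_of_le_one_of_nonpos hδ hδ1 (by linarith)
  have hmin : 0 < min (ρ / 10) 1 := lt_min hρ0 one_pos
  have hinv : 0 ≤ ((min (ρ / 10) 1) ^ s)⁻¹ := by positivity
  refine (isDeltaSet_of_ncard_le (C := 2 * 10 ^ s' * δ ^ (-η)) hδ hs hss' hmin (min_le_right _ _)
    (by positivity) h1 fun x r hr hrρ => ?_).mono_const hδ (by nlinarith)
  have hr0 : 0 < r := hδ.trans_le hr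
  refine (hP x r hr (hrρ.trans (min_le_left _ _))).trans ?_
  rw [Real.div_rpow hr0.le hδ.le, div_le_iff₀ hδs]
  have h2 : δ ^ η * δ ^ (-η) = 1 := by rw [← Real.rpow_add hδ, add_neg_cancel, Real.rpow_zero]
  have h3 : 1 ≤ 2 * 10 ^ s' * δ ^ s' * P.card * δ ^ (-η) := by
    rw [← h2]
    gcongr
  calc r ^ s' = r ^ s' * 1 := by rw [mul_one]
    _ ≤ r ^ s' * (2 * 10 ^ s' * δ ^ s' * P.card * δ ^ (-η)) := by gcongr
    _ = _ := by ring

/-! ### Uniform choice of exponent, scale and class, and the conclusion. -/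

open MeasureTheory Metric Set in
/-- The points `x` of the exceptional set, at distance at most `N` from the origin, for which the
projection of `μ` from `x` has lower dimension about `d`. -/
def exceptionalPart (μ : Measure Plane) (K : Set Plane) (σ η d : ℝ) (n N : ℕ) : Set Plane :=
  {x | x ∈ exceptionalSet K σ ∧ ‖x‖ ≤ N ∧ μ (regularPart μ K (PlaneLine.join x) d n) ≠ 0 ∧
    ∀ m, μ (regularPart μ K (PlaneLine.join x) (d + η) m) = 0}

open MeasureTheory Metric Set in
theorem exists_outerMeasure_exceptionalPart_ne_zero {μ : Measure Plane} [IsProbabilityMeasure μ]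
    {K : Set Plane} {σ η : ℝ} {O : OuterMeasure Plane} (hK : μ K ≠ 0) (hσ : 0 < σ) (hη : 0 < η)
    (hO : O (exceptionalSet K σ) ≠ 0) :
    ∃ i n N : ℕ, i * η < σ ∧ O (exceptionalPart μ K σ η (i * η) n N) ≠ 0 := by
  by_contra! hcon
  refine hO (measure_mono_null (t := ⋃ p : {p : ℕ × ℕ × ℕ // p.1 * η < σ},
    exceptionalPart μ K σ η (p.1.1 * η) p.1.2.1 p.1.2.2) ?_
    (measure_iUnion_null fun p => hcon _ _ _ p.2))
  intro x hx
  have hdim : dimH (PlaneLine.join x '' K) < ENNReal.ofReal σ :=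
    (PlaneLine.dimH_image_join_le hx.1).trans_lt hx.2
  obtain ⟨i, n, hi, h1, h2⟩ := exists_measure_regularPart_ne_zero hK hσ hη hdim
  obtain ⟨N, hN⟩ := exists_nat_ge ‖x‖
  exact mem_iUnion.2 ⟨⟨(i, n, N), hi⟩, hx, hN, h1, h2⟩

open MeasureTheory Metric Set in
/-- At infinitely many dyadic scales, many points of the exceptional part see a large good part of
one mass class. -/
theorem exists_le_outerMeasure_setOf_goodPart {μ : Measure Plane} [IsProbabilityMeasure μ]
    {K : Set Plane} {σ η d c : ℝ} {n N : ℕ} {O : OuterMeasure Plane} {ι : Type*} [Fintype ι]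
    {A : ℕ → ι → Set Plane} {B : ℕ → Set Plane} {CB : ℝ} (hK : IsCompact K) (hd : 0 ≤ d)
    (hη : 0 < η) (hc : 0 < c) (hO : O (exceptionalPart μ K σ η d n N) ≠ 0)
    (hcov : ∀ k, K ⊆ B k ∪ ⋃ i, A k i)
    (hB : ∀ k, μ (B k) ≤ ENNReal.ofReal (CB * (1 / 2 : ℝ) ^ k)) (k₀ : ℕ) :
    ∃ k ≥ k₀, ∃ i, ENNReal.ofReal (((1 / 2 : ℝ) ^ k) ^ η) ≤
      O {x | x ∈ exceptionalPart μ K σ η d n N ∧ ENNReal.ofReal (((1 / 2 : ℝ) ^ k) ^ (2 * η)) ≤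
        μ (goodPart μ K (PlaneLine.join x) d η c n (A k i) ((1 / 2 : ℝ) ^ k))} := by
  -- The comparison series carries the number of classes as a factor, so subadditivity leaves one
  -- class whose set of `x` has `O`-mass at least `Δ ^ η`.
  obtain ⟨k, hk, hlt⟩ := exists_lt_measure_of_frequently (μ := O)
    (A := exceptionalPart μ K σ η d n N) (N := ∅)
    (M := fun k => ⋃ i, {x | x ∈ exceptionalPart μ K σ η d n N ∧
      ENNReal.ofReal (((1 / 2 : ℝ) ^ k) ^ (2 * η)) ≤
        μ (goodPart μ K (PlaneLine.join x) d η c n (A k i) ((1 / 2 : ℝ) ^ k))})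
    hO measure_empty (by
      intro x hx
      refine Or.inr fun k₁ => ?_
      obtain ⟨k, hk, i, hi⟩ := exists_le_measure_goodPart hK.isClosed
        (PlaneLine.continuousOn_join hx.1.1) hd hη hc hx.2.2.1 hx.2.2.2 hcov hB k₁
      exact ⟨k, hk, mem_iUnion.2 ⟨i, hx, hi⟩⟩)
    (tsum_ofReal_const_mul_pow_rpow_ne_top (Fintype.card ι : ℝ) hη) k₀
  refine ⟨k, hk, ?_⟩
  by_contra! hcon
  refine absurd hlt (not_lt.2 ((measure_iUnion_fintype_le _ _).trans
    ((Finset.sum_le_sum fun i _ => (hcon i).le).trans (le_of_eq ?_))))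
  rw [sum_const_ofReal _ (by positivity), Finset.card_univ, mul_comm]

open MeasureTheory Metric Set in
theorem mainTheorem4 (t σ s : ℝ) (ht : t ∈ Set.Icc (0 : ℝ) 2) (hσ : σ ∈ Set.Ioo (0 : ℝ) 1)
    (K : Set Plane) (hK : IsCompact K) (hKB : K ⊆ Metric.closedBall (0 : Plane) 1)
    (hKdim : ENNReal.ofReal t < dimH K) (hs : 0 ≤ s)
    (hEdim : ENNReal.ofReal s < dimH (exceptionalSet K σ))
    (δ₀ : ℝ) (hδ₀ : δ₀ ∈ Set.Ioo (0 : ℝ) 1) (ε : ℝ) (hε : ε ∈ Set.Ioo (0 : ℝ) (1 - σ)) :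
    ∃ Δ ∈ Set.Ioc (0 : ℝ) δ₀, ∃ S : ℝ, 0 ≤ S ∧ S ≤ σ + ε ∧
      ∃ P_K P_E : Set Plane,
        (P_K ⊆ K ∧ P_K.Nonempty ∧ P_K.Finite ∧
          Metric.IsSeparated (ENNReal.ofReal Δ) P_K ∧ IsDeltaSet Δ t (Δ ^ (-ε)) P_K) ∧
        (P_E ⊆ exceptionalSet K σ ∧ P_E.Nonempty ∧ P_E.Finite ∧
          Metric.IsSeparated (ENNReal.ofReal Δ) P_E ∧ IsDeltaSet Δ s (Δ ^ (-ε)) P_E) ∧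
        ∀ x ∈ P_E, ∃ 𝒯 : Set (Set Plane),
          𝒯.Nonempty ∧ IsDeltaTubeSet Δ S (Δ ^ (-ε)) 𝒯 ∧
          ∀ T ∈ 𝒯, x ∈ T ∧
            Δ ^ (S + ε) * (P_K.ncard : ℝ) ≤ ((T ∩ P_K).ncard : ℝ) := by
  have hε0 : 0 < ε := hε.1
  obtain ⟨t', htt', ht'⟩ := exists_lt_ofReal_lt ht.1 hKdim
  obtain ⟨s', hss', hs'⟩ := exists_lt_ofReal_lt hs hEdim
  obtain ⟨μ, hμprob, hμK, Cμ, hCμ, hμ⟩ := exists_frostman_measure hK (ht.1.trans htt'.le) ht'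
  obtain ⟨O, ρ, hρ, hOE, hO⟩ := exists_outerMeasure_of_lt_dimH (hs.trans hss'.le) hs'
  have hμK' : μ K ≠ 0 := by
    intro h0
    have := measure_univ (μ := μ)
    rw [← union_compl_self K, measure_union_null h0 hμK] at this
    exact zero_ne_one this
  -- The losses to be absorbed are `η` for `P_E`, `3 * η` for `P_K` and the lines, and `4 * η` for
  -- the tube counts.
  set η := ε / 5 with hη
  have hη0 : 0 < η := by positivity
  obtain ⟨J, hJ⟩ := exists_nat_ge (3 / η)
  rw [div_le_iff₀ hη0] at hJ
  choose M B hcov hB using fun k : ℕ => exists_massClass_cover (μ := μ) (η := η) hK hKB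
    (show (0 : ℝ) < (1 / 2) ^ k by positivity) (pow_le_one₀ (by norm_num) (by norm_num)) hJ
  obtain ⟨i, n, N, hi, hOpart⟩ := exists_outerMeasure_exceptionalPart_ne_zero hμK' hσ.1 hη0 hOE
  set d := i * η with hd
  have hd0 : 0 ≤ d := by positivity
  -- Points of `K` are at distance at most `N + 1` from `x`, so lines `c * Δ`-close to each other
  -- are `Δ / 2`-close there.
  set c : ℝ := 1 / (2 * ((N : ℝ) + 1)) with hc
  have hN : (0 : ℝ) ≤ N := Nat.cast_nonneg N
  have hc0 : 0 < c := by positivity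
  have hc1 : c ≤ 1 := by
    rw [hc, div_le_one (by positivity)]
    linarith
  obtain ⟨k₁, hk₁⟩ := exists_forall_mul_rpow_neg_le
    (2 * 10 ^ s' + ((min (ρ / 10) 1) ^ s)⁻¹) (show η < ε by linarith)
  obtain ⟨k₂, hk₂⟩ := exists_forall_mul_rpow_neg_le (Cμ * 2 ^ t' + 1) (show 3 * η < ε by linarith)
  obtain ⟨k₃, hk₃⟩ := exists_forall_mul_rpow_neg_le
    ((3 * ((n : ℝ) + 1)) ^ d * 2 ^ d * (c / 4) ^ (-(d + η))) (show 3 * η < ε by linarith)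
  obtain ⟨k₄, hk₄⟩ := exists_forall_pow_half_le
    (show 0 < min δ₀ (min (ρ / 10) (1 / ((n : ℝ) + 1) / 2)) from
      lt_min hδ₀.1 (lt_min (by positivity) (by positivity)))
  obtain ⟨k, hk, κ, hκ⟩ := exists_le_outerMeasure_setOf_goodPart (A := fun k κ => (M k κ).carrier)
    hK hd0 hη0 hc0 hOpart hcov hB (k₁ ⊔ k₂ ⊔ k₃ ⊔ k₄)
  simp only [ge_iff_le, sup_le_iff] at hk
  obtain ⟨⟨⟨hkk₁, hkk₂⟩, hkk₃⟩, hkk₄⟩ := hk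
  have hsmall := hk₄ k hkk₄
  replace hk₁ := hk₁ k hkk₁
  replace hk₂ := hk₂ k hkk₂
  replace hk₃ := hk₃ k hkk₃
  have hΔ : (0 : ℝ) < (1 / 2 : ℝ) ^ k := by positivity
  set Δ : ℝ := (1 / 2 : ℝ) ^ k with hΔdef
  rw [le_min_iff, le_min_iff] at hsmall
  have hΔ1 : Δ ≤ 1 := hsmall.1.trans hδ₀.2.le
  set G : Set Plane := {x | x ∈ exceptionalPart μ K σ η d n N ∧ ENNReal.ofReal (Δ ^ (2 * η)) ≤
    μ (goodPart μ K (PlaneLine.join x) d η c n (M k κ).carrier Δ)} with hG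
  have hGbdd : TotallyBounded G :=
    (isCompact_closedBall (0 : Plane) N).totallyBounded.subset fun x hx => by
      simpa using hx.1.2.1
  obtain ⟨P, hPG, hPne, hPsep, hPset⟩ := exists_isDeltaSet_of_le_outerMeasure hO hGbdd hs hss'.le
    hΔ hΔ1 hsmall.2.1 hη0.le hκ
  have hgood : ∀ x, goodPart μ K (PlaneLine.join x) d η c n (M k κ).carrier Δ ⊆
      (M k κ).carrier := fun x y hy => hy.1.2.1
  obtain ⟨x₀, hx₀⟩ := hPne
  have hM : ENNReal.ofReal (Δ ^ (2 * η)) ≤ μ (M k κ).carrier :=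
    (hPG hx₀).2.trans (measure_mono (hgood x₀))
  have hΔ2 : 0 < Δ ^ (2 * η) := Real.rpow_pos_of_pos hΔ _
  have hMne : (M k κ).points.Nonempty := by
    rw [Finset.nonempty_iff_ne_empty]
    intro h0
    have h1 := hM.trans ((inter_univ (M k κ).carrier ▸ (M k κ).measure_le univ))
    rw [h0] at h1
    simp only [Finset.coe_empty, empty_inter, ncard_empty, Nat.cast_zero, mul_zero,
      ENNReal.ofReal_zero, nonpos_iff_eq_zero, ENNReal.ofReal_eq_zero] at h1
    linarith
  refine ⟨Δ, ⟨hΔ, hsmall.1⟩, d, hd0, by linarith, (M k κ).points, P,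
    ⟨(M k κ).points_subset, hMne, (M k κ).points.finite_toSet,
      isSeparated_of_ncard_le_one hΔ.le (M k κ).ncard_le_one,
      ((M k κ).isDeltaSet hΔ hΔ1 hη0.le ht.1 htt'.le hCμ.le hμ hM).mono_const hΔ hk₂⟩,
    ⟨fun x hx => (hPG hx).1.1, ⟨x₀, hx₀⟩, P.finite_toSet, hPsep, hPset.mono_const hΔ hk₁⟩, ?_⟩
  intro x hx
  have hxG := hPG hx
  refine ⟨PlaneLine.tube Δ '' (PlaneLine.join x ''
    goodPart μ K (PlaneLine.join x) d η c n (M k κ).carrier Δ), ?_, ⟨_, rfl, ?_⟩, ?_⟩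
  · refine Set.Nonempty.image _ (Set.Nonempty.image _ ?_)
    rw [Set.nonempty_iff_ne_empty]
    intro h0
    have h1 := hxG.2
    rw [h0, measure_empty, nonpos_iff_eq_zero, ENNReal.ofReal_eq_zero] at h1
    linarith
  · refine (isDeltaSet_image hK hK.isClosed (PlaneLine.continuousOn_join hxG.1.1.1) hd0 hc0 hc1 hΔ
      ?_ (fun y hy => hy.1) hxG.2).mono_const hΔ hk₃
    linarith [hsmall.2.2]
  · rintro _ ⟨_, ⟨y, hy, rfl⟩, rfl⟩
    refine ⟨self_subset_cthickening _ (PlaneLine.mem_join_left x y), ?_⟩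
    have hcx : c * (‖x‖ + 1) ≤ 1 / 2 := by
      have h1 : ‖x‖ ≤ N := hxG.1.2.1
      calc c * (‖x‖ + 1) ≤ c * ((N : ℝ) + 1) := by gcongr
        _ = 1 / 2 := by rw [hc]; field_simp
    refine le_trans ?_ (le_ncard_tube_inter (M k κ) hΔ hcx hKB hy)
    refine mul_le_mul_of_nonneg_right ?_ (Nat.cast_nonneg _)
    exact Real.rpow_le_rpow_of_exponent_ge hΔ hΔ1 (by linarith)
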